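/- Let $U$ be a universal prefix-free Turing machine, that is, a partial computable function on bit strings whose halting programs form a prefix-free set, such that for every other such machine $V$ there is a constant $c_V$ with: whenever $V(p)=x$, there is $q$ with $|q|\le |p|+c_V$ and $U(q)=x$. Let $B$ be a finite universal set of quantum gates (for all sufficiently large $n$, its circuits on $n$ qubits approximate every unitary arbitrarily well up to a global phase) whose entries are computable complex numbers. Circuits over $B$ are described by bit strings in a fixed effective way. For an $n$-qubit pure state $|\psi\rangle$ let $K_{\mathrm{net}}(|\psi\rangle)$ be the least length of a program $p$ such that $U(p)$ describes an $n$-qubit circuit $C$ over $B$ with $|\langle\psi|C|0^n\rangle|^2=1$ ($\infty$ if there is none). Let $\mu_n=\sum_p 2^{-|p|}\,C_p|0^n\rangle\langle 0^n|C_p^\dagger$, the sum over all programs $p$ such that $U(p)$ describes an $n$-qubit circuit $C_p$; let $\overline H(|\psi\rangle)=-\log_2\langle\psi|\mu_n|\psi\rangle$ ($\infty$ if $\langle\psi|\mu_n|\psi\rangle=0$), and for $\delta\in[0,1]$ let $\overline H^{\delta}(|\psi\rangle)$ be the supremum of $\overline H(|\phi\rangle)$ over the pure states $|\phi\rangle$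 at trace distance at most $\delta$ from $|\psi\rangle$. The $\gamma$-robust span of a finite nonempty family of $L$ pure states is the span of those eigenvectors of their uniform mixture whose eigenvalue is at least $\gamma/L$ (the robust span of the empty family is $0$). **Theorem.** There are a constant $c$ and a polynomial $P$, depending only on $U$ and $B$, such that for all $n\ge 1$, $\varepsilon\in[0,1]$, $\gamma\ge 0$, $r\in\mathbb R$ and every $n$-qubit pure state $|\psi\rangle$ with $\overline H^{1-\varepsilon}(|\psi\rangle)\le r$, $$\langle\psi|\Pi_{r,\gamma}|\psi\rangle\ \ge\ 1-\sqrt{2\varepsilon}-\gamma\,P(n),$$ where $\Pi_{r,\gamma}$ is the orthogonal projector onto the $\gamma$-robust span of the finite family of all $n$-qubit pure states (up to global phase) with $K_{\mathrm{net}}$ at most $r+c\,(1+\log_2 n)$. -/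

import Mathlib

open scoped Matrix

noncomputable section

namespace QKol

/-! ### Prefix-free machines -/

/-- A prefix-free machine: a partial computable function on bit strings, no two halting programs of
which are proper prefixes of one another. -/
def IsPrefixFreeMachine (V : List Bool →. List Bool) : Prop :=
  Partrec V ∧ ∀ p q, (V p).Dom → (V q).Dom → p <+: q → p = q

/-- A universal prefix-free machine: it simulates every prefix-free machine with a constant overhead
in the program length. -/
def IsUniversalMachine (U : List Bool →. List Bool) : Prop :=
  IsPrefixFreeMachine U ∧
    ∀ V : List Bool →. List Bool, IsPrefixFreeMachine V →
      ∃ c : ℕ, ∀ p x, x ∈ V p → ∃ q, x ∈ U q ∧ q.length ≤ p.length + c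

/-! ### Gates and circuits -/

/-- The state space of `n` qubits, with computational basis indexed by `Fin n → Bool`. -/
abbrev Qubits (n : ℕ) : Type := EuclideanSpace ℂ (Fin n → Bool)

/-- Operators on `n` qubits, as matrices in the computational basis. -/
abbrev Op (n : ℕ) : Type := Matrix (Fin n → Bool) (Fin n → Bool) ℂ

/-- A finite set of quantum gates: `gate g` is a unitary on `arity g` qubits. -/
structure GateSet where
  size : ℕ
  arity : Fin size → ℕ
  gate : ∀ g : Fin size, Matrix.unitaryGroup (Fin (arity g) → Bool) ℂ

/-- One step of a circuit on `n` qubits: a gate and the (distinct) wires to which it is applied. -/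
structure Step (B : GateSet) (n : ℕ) where
  gate : Fin B.size
  wires : Fin (B.arity gate) ↪ Fin n

/-- The operator on `n` qubits that acts as `G` on the wires `w` and as the identity on the rest. -/
def applyOn {a n : ℕ} (G : Op a) (w : Fin a ↪ Fin n) : Op n :=
  open Classical in
  fun x y => if ∀ j, j ∉ Set.range w → x j = y j then G (x ∘ w) (y ∘ w) else 0

/-- The circuits on `n` qubits over the gate set `B`: finite sequences of steps, executed from the
head of the list on. -/
abbrev Circuit (B : GateSet) (n : ℕ) : Type := List (Step B n)

/-- The unitary that a circuit implements. -/
def Circuit.unitary {B : GateSet} {n : ℕ} : Circuit B n → Op n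
  | [] => 1
  | g :: C => Circuit.unitary C * applyOn (B.gate g.gate : Op (B.arity g.gate)) g.wires

/-- The output state `C|0ⁿ⟩`. -/
def Circuit.output {B : GateSet} {n : ℕ} (C : Circuit B n) : Qubits n :=
  WithLp.toLp 2 (Circuit.unitary C *ᵥ Pi.single (fun _ => false) 1)

/-- The classical description of a circuit as a bit string: the binary digits of the code of the
number of qubits together with the list of steps, a step being given by the index of its gate
and the list of its wires. -/
def Circuit.description {B : GateSet} {n : ℕ} (C : Circuit B n) : List Bool :=
  Nat.bits (Encodable.encode
    ((n, C.map fun g => ((g.gate : ℕ), List.ofFn fun i => (g.wires i : ℕ))) :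
      ℕ × List (ℕ × List ℕ)))

/-- A gate set is universal if its circuits approximate every unitary on `n` qubits arbitrarily
well, up to a global phase, for all sufficiently large `n`. -/
def GateSet.IsUniversal (B : GateSet) : Prop :=
  ∃ n₀ : ℕ, ∀ n, n₀ ≤ n → ∀ V ∈ Matrix.unitaryGroup (Fin n → Bool) ℂ, ∀ δ : ℝ, 0 < δ →
    ∃ (C : Circuit B n) (z : ℂ), ‖z‖ = 1 ∧ ∀ x y, ‖Circuit.unitary C x y - z * V x y‖ ≤ δ

/-- A real number with computable dyadic approximations. -/
def IsComputableReal (x : ℝ) : Prop :=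
  ∃ f : ℕ → ℤ, Computable f ∧ ∀ k, |x - (f k : ℝ) / 2 ^ k| ≤ 1 / 2 ^ k

/-- All entries of the gates are computable complex numbers. -/
def GateSet.HasComputableAmplitudes (B : GateSet) : Prop :=
  ∀ g x y, IsComputableReal ((B.gate g : Op (B.arity g)) x y).re ∧
    IsComputableReal ((B.gate g : Op (B.arity g)) x y).im

/-! ### Pure states and trace distance -/

/-- `|v⟩⟨v|`. For unit vectors, two of these are equal iff the vectors agree up to a phase. -/
def ketbra {n : ℕ} (v : Qubits n) : Op n := Matrix.vecMulVec v.ofLp (star v.ofLp)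

/-- The Schatten 1-norm `Tr √(Aᴴ A)`: the sum of the singular values. -/
def schattenOne {n : ℕ} (A : Op n) : ℝ :=
  ∑ i, √((Matrix.isHermitian_conjTranspose_mul_self A).eigenvalues i)

/-- The trace distance of two pure states. -/
def traceDist {n : ℕ} (v w : Qubits n) : ℝ := schattenOne (ketbra v - ketbra w) / 2

/-! ### Complexity of quantum states -/

/-- The error-`ε` `Knet` complexity of a state: the least length of a program for a circuit whose
output has squared overlap at least `1 - ε` with the state (`⊤` if there is none). -/
def Knet (U : List Bool →. List Bool) (B : GateSet) (ε : ℝ) {n : ℕ} (v : Qubits n) : ℕ∞ :=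
  sInf {k | ∃ (p : List Bool) (C : Circuit B n), Circuit.description C ∈ U p ∧
    1 - ε ≤ ‖inner ℂ v (Circuit.output C)‖ ^ 2 ∧ k = p.length}

/-- The universal semi-density matrix on `n` qubits: the sum of `2^(-|p|) |C 0ⁿ⟩⟨C 0ⁿ|` over all
programs `p` whose output describes a circuit `C` on `n` qubits. -/
def semiDensity (U : List Bool →. List Bool) (B : GateSet) (n : ℕ) : Op n :=
  ∑' x : {x : List Bool × Circuit B n // Circuit.description x.2 ∈ U x.1},
    ((2 : ℂ) ^ x.1.1.length)⁻¹ • ketbra (Circuit.output x.1.2)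

/-- `⟨v|A|v⟩`, for Hermitian `A`. -/
def expect {n : ℕ} (A : Op n) (v : Qubits n) : ℝ := (inner ℂ v (Matrix.toEuclideanLin A v)).re

/-- The `H̄` complexity `-log₂ ⟨v|μ|v⟩`, which is `⊤` if `⟨v|μ|v⟩ = 0`. -/
def Hbar (U : List Bool →. List Bool) (B : GateSet) {n : ℕ} (v : Qubits n) : EReal :=
  open Classical in
  if expect (semiDensity U B n) v = 0 then ⊤
  else ((-Real.logb 2 (expect (semiDensity U B n) v) : ℝ) : EReal)

/-- The smoothed complexity `H̄^δ`: the supremum of `H̄` over the pure states within trace distance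
`δ`. -/
def HbarSmooth (U : List Bool →. List Bool) (B : GateSet) (δ : ℝ) {n : ℕ} (v : Qubits n) : EReal :=
  ⨆ (w : Qubits n) (_ : ‖w‖ = 1 ∧ traceDist v w ≤ δ), Hbar U B w

/-! ### Robust span -/

/-- The `γ`-robust span of a finite family of pure states, given by their projectors: the span of
the eigenvectors of their uniform mixture with eigenvalue at least `γ / L`, where `L` is the number
of members. The robust span of the empty family is zero. -/
def robustSpan {n : ℕ} {ι : Type*} [Fintype ι] (ρ : ι → Op n) (γ : ℝ) : Submodule ℂ (Qubits n) :=
  Submodule.span ℂ {v | Nonempty ι ∧ ∃ t : ℝ, γ / Fintype.card ι ≤ t ∧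
    Matrix.toEuclideanLin ((Fintype.card ι : ℂ)⁻¹ • ∑ i, ρ i) v = (t : ℂ) • v}

/-- The pure states on `n` qubits, identified with their projectors, with exact `Knet` complexity at
most `s`. -/
def easyStates (U : List Bool →. List Bool) (B : GateSet) (n : ℕ) (s : ℝ) : Set (Op n) :=
  {ρ | ∃ v : Qubits n, ‖v‖ = 1 ∧ ((Knet U B 0 v : ENNReal) : EReal) ≤ (s : EReal) ∧ ρ = ketbra v}

/-! ### Well-definedness -/

theorem description_injective {B : GateSet} {n : ℕ} :
    Function.Injective (Circuit.description (B := B) (n := n)) := by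
  intro C C' h
  have h1 : Function.Injective Nat.bits := fun a b hab => by
    rw [← Nat.ofDigits_digits 2 a, ← Nat.ofDigits_digits 2 b, Nat.digits_two_eq_bits,
      Nat.digits_two_eq_bits, hab]
  have h2 := congrArg Prod.snd (Encodable.encode_injective (h1 h))
  refine List.map_injective_iff.mpr ?_ h2
  rintro ⟨g, w⟩ ⟨g', w'⟩ h
  obtain ⟨hg, hw⟩ := Prod.mk.inj h
  obtain rfl := Fin.ext hg
  have h3 := List.ofFn_injective hw
  congr 1
  ext i
  exact congrFun h3 i

theorem applyOn_mem_unitary {a n : ℕ} {G : Op a} (hG : G ∈ Matrix.unitaryGroup (Fin a → Bool) ℂ)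
    (w : Fin a ↪ Fin n) : applyOn G w ∈ Matrix.unitaryGroup (Fin n → Bool) ℂ := by
  classical
  have key : ∀ H K : Op a, applyOn H w * applyOn K w = applyOn (H * K) w := by
    intro H K
    ext x z
    have hinj : ∀ s : Fin a → Bool, Function.extend w s x ∘ w = s := fun s =>
      funext fun i => w.injective.extend_apply _ _ _
    have hout : ∀ (s : Fin a → Bool) (j : Fin n), j ∉ Set.range w → Function.extend w s x j = x j :=
      fun s j hj => Function.extend_apply' _ _ _ hj
    rw [Matrix.mul_apply]
    have hsum : ∑ y, applyOn H w x y * applyOn K w y z =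
        ∑ s : Fin a → Bool, applyOn H w x (Function.extend w s x) *
          applyOn K w (Function.extend w s x) z := by
      symm
      refine Finset.sum_of_injOn (fun s => Function.extend w s x) ?_ (by simp) ?_ (by simp)
      · intro s _ t _ hst
        rw [← hinj s, ← hinj t]
        exact congrArg (· ∘ w) hst
      · intro y _ hy
        have : ¬ ∀ j, j ∉ Set.range w → x j = y j := by
          intro h
          refine hy ⟨y ∘ w, by simp, ?_⟩
          ext j
          by_cases hj : j ∈ Set.range w
          · obtain ⟨i, rfl⟩ := hj
            exact w.injective.extend_apply _ _ _
          · exact (hout _ j hj).trans (h j hj)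
        simp [applyOn, -Set.mem_range, this]
    rw [hsum]
    by_cases hxz : ∀ j, j ∉ Set.range w → x j = z j
    · simp only [applyOn]
      rw [if_pos hxz, Matrix.mul_apply]
      refine Finset.sum_congr rfl fun s _ => ?_
      rw [if_pos (fun j hj => (hout s j hj).symm), if_pos (fun j hj => (hout s j hj).trans (hxz j hj)),
        hinj]
    · simp only [applyOn]
      rw [if_neg hxz]
      refine Finset.sum_eq_zero fun s _ => ?_
      have hneg : ¬ ∀ j, j ∉ Set.range w → Function.extend w s x j = z j :=
        fun h => hxz fun j hj => (hout s j hj).symm.trans (h j hj)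
      simp only [hneg, if_false, mul_zero]
  have hstar : star (applyOn G w) = applyOn (star G) w := by
    ext x y
    simp only [Matrix.star_apply, applyOn, apply_ite star, star_zero]
    simp only [eq_comm]
  have hone : applyOn (1 : Op a) w = 1 := by
    ext x y
    by_cases h : x = y
    · subst h
      simp [applyOn]
    · rw [Matrix.one_apply_ne h]
      by_cases h' : ∀ j, j ∉ Set.range w → x j = y j
      · have : x ∘ w ≠ y ∘ w := by
          intro hw
          refine h (funext fun j => ?_)
          by_cases hj : j ∈ Set.range w
          · obtain ⟨i, rfl⟩ := hj
            exact congrFun hw i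
          · exact h' j hj
        simp only [applyOn]
        rw [if_pos h', Matrix.one_apply_ne this]
      · simp only [applyOn]
        rw [if_neg h']
  rw [Matrix.mem_unitaryGroup_iff, hstar, key, (Matrix.mem_unitaryGroup_iff).1 hG, hone]

theorem unitary_mem {B : GateSet} {n : ℕ} (C : Circuit B n) :
    Circuit.unitary C ∈ Matrix.unitaryGroup (Fin n → Bool) ℂ := by
  induction C with
  | nil => exact one_mem _
  | cons g C ih => exact mul_mem ih (applyOn_mem_unitary (B.gate g.gate).2 g.wires)

theorem norm_output {B : GateSet} {n : ℕ} (C : Circuit B n) : ‖Circuit.output C‖ = 1 := by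
  have h := (Matrix.mem_unitaryGroup_iff').1 (unitary_mem C)
  have h2 := congrFun (congrFun h fun _ => false) fun _ => false
  rw [Matrix.mul_apply, Matrix.one_apply_eq] at h2
  rw [EuclideanSpace.norm_eq, Real.sqrt_eq_one]
  have : ∀ x, (Circuit.output C) x = Circuit.unitary C x fun _ => false := fun x => by
    simp [Circuit.output]
  simp only [this]
  have h3 := congrArg Complex.re h2
  rw [Complex.re_sum, Complex.one_re] at h3
  rw [← h3]
  refine Finset.sum_congr rfl fun x _ => ?_
  rw [Matrix.star_apply, ← Complex.normSq_eq_norm_sq, Complex.star_def,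
    ← Complex.normSq_eq_conj_mul_self, Complex.ofReal_re]

theorem kraft {S : Finset (List Bool)} (hS : ∀ p ∈ S, ∀ q ∈ S, p <+: q → p = q) :
    ∑ p ∈ S, ((2 : ℝ) ^ p.length)⁻¹ ≤ 1 := by
  by_cases h0 : [] ∈ S
  · have : S = {[]} := by
      ext p
      simp only [Finset.mem_singleton]
      exact ⟨fun hp => (hS [] h0 p hp p.nil_prefix).symm, fun hp => hp ▸ h0⟩
    simp [this]
  · have hu : InformationTheory.UniquelyDecodable (S : Set (List Bool)) := by
      intro L₁
      induction L₁ with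
      | nil =>
        intro L₂ _ h2 h
        cases L₂ with
        | nil => rfl
        | cons b L₂ =>
          have hb : b = [] := by simp at h; exact h.1
          exact absurd (hb ▸ h2 b (by simp)) h0
      | cons a L₁ ih =>
        intro L₂ h1 h2 h
        cases L₂ with
        | nil =>
          have ha : a = [] := by simp at h; exact h.1
          exact absurd (ha ▸ h1 a (by simp)) h0
        | cons b L₂ =>
          have ha : a ∈ S := h1 a (by simp)
          have hb : b ∈ S := h2 b (by simp)
          rw [List.flatten_cons, List.flatten_cons] at h
          have hab : a = b := by
            rcases List.prefix_or_prefix_of_prefix (List.prefix_append a L₁.flatten)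
              (h ▸ List.prefix_append b L₂.flatten) with h' | h'
            · exact hS a ha b hb h'
            · exact (hS b hb a ha h').symm
          subst hab
          rw [ih L₂ (fun w hw => h1 w (List.mem_cons_of_mem _ hw))
            (fun w hw => h2 w (List.mem_cons_of_mem _ hw)) (List.append_cancel_left h)]
    simpa using InformationTheory.kraft_mcmillan_inequality hu

/-- The series that defines the universal semi-density matrix converges. -/
theorem semiDensity_summable {U : List Bool →. List Bool} (hU : IsPrefixFreeMachine U)
    (B : GateSet) (n : ℕ) :
    Summable fun x : {x : List Bool × Circuit B n // Circuit.description x.2 ∈ U x.1} =>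
      ((2 : ℂ) ^ x.1.1.length)⁻¹ • ketbra (Circuit.output x.1.2) := by
  classical
  have hinj : Function.Injective
      fun x : {x : List Bool × Circuit B n // Circuit.description x.2 ∈ U x.1} => x.1.1 := by
    rintro ⟨⟨p, C⟩, hx⟩ ⟨⟨q, C'⟩, hy⟩ h
    obtain rfl : p = q := h
    obtain rfl : C = C' := description_injective (Part.mem_unique hx hy)
    rfl
  have hs : Summable
      fun x : {x : List Bool × Circuit B n // Circuit.description x.2 ∈ U x.1} =>
        ((2 : ℝ) ^ x.1.1.length)⁻¹ := by
    refine summable_of_sum_le (c := 1) (fun x => by positivity) fun T => ?_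
    have := kraft (S := T.image fun x => x.1.1) (by
      intro p hp q hq hpq
      obtain ⟨x, _, rfl⟩ := Finset.mem_image.1 hp
      obtain ⟨y, _, rfl⟩ := Finset.mem_image.1 hq
      exact hU.2 _ _ (Part.dom_iff_mem.2 ⟨_, x.2⟩) (Part.dom_iff_mem.2 ⟨_, y.2⟩) hpq)
    rwa [Finset.sum_image fun x _ y _ h => hinj h] at this
  refine Pi.summable.2 fun i => Pi.summable.2 fun j => ?_
  refine Summable.of_norm_bounded hs fun x => ?_
  have hle : ∀ i, ‖(Circuit.output x.1.2).ofLp i‖ ≤ 1 := fun i =>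
    (PiLp.norm_apply_le (Circuit.output x.1.2) i).trans (norm_output x.1.2).le
  change ‖((2 : ℂ) ^ x.1.1.length)⁻¹ * ((Circuit.output x.1.2).ofLp i *
    star ((Circuit.output x.1.2).ofLp j))‖ ≤ _
  rw [norm_mul, norm_mul, norm_star, norm_inv, norm_pow, Complex.norm_ofNat]
  have := mul_le_one₀ (hle i) (norm_nonneg _) (hle j)
  exact mul_le_of_le_one_right (by positivity) this

theorem easyStates_finite (U : List Bool →. List Bool) (B : GateSet) (n : ℕ) (s : ℝ) :
    (easyStates U B n s).Finite := by
  have hfin : {p : List Bool | p.length ≤ ⌊s⌋₊}.Finite := List.finite_length_le Bool _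
  have hfin2 : (⋃ p ∈ {p : List Bool | p.length ≤ ⌊s⌋₊},
      {C : Circuit B n | Circuit.description C ∈ U p}).Finite := by
    refine hfin.biUnion fun p _ => Set.Subsingleton.finite ?_
    intro C hC C' hC'
    exact description_injective (Part.mem_unique hC hC')
  refine (hfin2.image fun C => ketbra (Circuit.output C)).subset ?_
  rintro _ ⟨v, hv, hk, rfl⟩
  have hne : {k | ∃ (p : List Bool) (C : Circuit B n), Circuit.description C ∈ U p ∧
    1 - 0 ≤ ‖inner ℂ v (Circuit.output C)‖ ^ 2 ∧ k = (p.length : ℕ∞)}.Nonempty := by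
    by_contra h
    rw [Set.not_nonempty_iff_eq_empty] at h
    rw [Knet, h] at hk
    simp at hk
  obtain ⟨p, C, hC, hov, hlen⟩ := csInf_mem hne
  refine ⟨C, Set.mem_biUnion (x := p) ?_ hC, ?_⟩
  · have hKn : Knet U B 0 v = (p.length : ℕ∞) := hlen
    rw [hKn] at hk
    have : (p.length : ℝ) ≤ s := by
      have h2 : ((p.length : ℝ) : EReal) ≤ (s : EReal) := by
        have h3 : (((p.length : ENNReal) : EReal)) = ((p.length : ℝ) : EReal) := by
          rw [← ENNReal.ofReal_natCast, EReal.coe_ennreal_ofReal, max_eq_left (Nat.cast_nonneg _)]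
        simpa [h3] using hk
      exact_mod_cast h2
    exact Nat.le_floor this
  · change ketbra (Circuit.output C) = ketbra v
    have hu : ‖Circuit.output C‖ = 1 := norm_output C
    generalize Circuit.output C = u at hu hov ⊢
    have h1 : ‖inner ℂ v u‖ = ‖v‖ * ‖u‖ := by
      refine le_antisymm (norm_inner_le_norm v u) ?_
      rw [hv, hu]
      nlinarith [norm_nonneg (inner ℂ v u)]
    have hv0 : v ≠ 0 := fun h => by simp [h] at hv
    have hu0 : u ≠ 0 := fun h => by simp [h] at hu
    obtain ⟨z, hz0, hz⟩ := (norm_inner_eq_norm_iff hv0 hu0).1 h1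
    have hz1 : ‖z‖ = 1 := by
      have := congrArg norm hz
      rw [norm_smul, hu, hv, mul_one] at this
      exact this.symm
    have hzz : z * star z = 1 := by
      rw [Complex.star_def, Complex.mul_conj, Complex.normSq_eq_norm_sq, hz1]
      simp
    ext x y
    subst hz
    simp only [ketbra, Matrix.vecMulVec_apply, Pi.star_apply, PiLp.smul_apply, smul_eq_mul,
      star_mul']
    linear_combination (v.ofLp x * star (v.ofLp y)) * hzz

/-- The `γ`-robust span of the (finite) family of all pure states on `n` qubits with `Knet`
complexity at most `s`. -/
def easyRobustSpan (U : List Bool →. List Bool) (B : GateSet) (n : ℕ) (s γ : ℝ) :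
    Submodule ℂ (Qubits n) :=
  robustSpan (fun ρ : (easyStates_finite U B n s).toFinset => (ρ : Op n)) γ

/-- `⟨v|Π|v⟩` for the orthogonal projector `Π` onto `K`. -/
def overlap {n : ℕ} (v : Qubits n) (K : Submodule ℂ (Qubits n)) : ℝ :=
  (inner ℂ v (K.starProjection v)).re

end QKol

end

/-! Write μ for the universal semi-density matrix. The programs can be enumerated and, the gate
entries being computable, so can approximations to the inner products of circuit outputs; hence
⟨f|μ|f⟩ is approximable from below for every circuit output f. Given n and k, one can therefore
search for circuits with outputs f_0, f_1, … such that ⟨f_j|μ|f_j⟩ + 2^-n > 2^-k and the total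
squared overlap of f_j with its predecessors is below 4^-(j+2). Both conditions are strict
inequalities, hence semidecidable, so each search succeeds whenever a suitable circuit exists
(`exists_search`).

The decaying thresholds keep the Gram matrix within 1/2 of the identity, so the family has frame
bounds 1/2 and 3/2 whatever the dimension. With Kraft's inequality the upper bound allows at most
3·2^k outputs (`card_le_of_nearly_orthonormal`), so the search gets stuck. A circuit found is
determined by n, k and an index of k + 2 bits, which a prefix-free machine reads from k + O(log n)
bits (`exists_machine`). Take k = min(⌈r⌉, n + 1): then all f_j are easy states. Circuit outputs are
dense up to phase, so once the search is stuck, every unit vector orthogonal to T = span{f_j} has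
μ-expectation below 2^-r (`expect_le_of_not_isGood`).

The rest is geometry (`le_overlap_easyRobustSpan`). If the component v of ψ orthogonal to T had ‖v‖²
> 2ε - ε², its normalisation would be a state within trace distance 1 - ε of ψ with complexity above
r. Let u be the component of ψ orthogonal to the robust span. All easy states together have weight
at most γ‖u‖² on u, so the lower frame bound gives ‖P_T u‖² ≤ 2γ‖u‖². Splitting ⟨ψ,u⟩ = ‖u‖² along T
and its complement gives ‖u‖ ≤ √(2γ) + ‖v‖, and squaring finishes.

The finitely many n below the threshold of universality are handled without a search: a basis of the
span of all outputs has programs of some bounded length and some positive frame constant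
(`exists_le_overlap_of_fixed`). The polynomial can therefore be taken constant. -/

noncomputable section

namespace QKol

/-! ### Computable functions in compositional form -/

attribute [fun_prop] Computable

section ComputableCalculus

variable {α β γ : Type} [Primcodable α] [Primcodable β] [Primcodable γ]

@[fun_prop]
theorem computable_id' : Computable (fun a : α => a) := Computable.id

@[fun_prop]
theorem computable_const' (b : β) : Computable (fun _ : α => b) := Computable.const b

@[fun_prop]
theorem computable_comp' {f : β → γ} {g : α → β} (hf : Computable f) (hg : Computable g) :
    Computable (fun a => f (g a)) := hf.comp hg

@[fun_prop]
theorem computable_fst' {f : α → β × γ} (hf : Computable f) : Computable (fun a => (f a).1) :=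
  Computable.fst.comp hf

@[fun_prop]
theorem computable_snd' {f : α → β × γ} (hf : Computable f) : Computable (fun a => (f a).2) :=
  Computable.snd.comp hf

@[fun_prop]
theorem computable_mk' {f : α → β} {g : α → γ} (hf : Computable f) (hg : Computable g) :
    Computable (fun a => (f a, g a)) := hf.pair hg

@[fun_prop]
theorem computable_add' {f g : α → ℕ} (hf : Computable f) (hg : Computable g) :
    Computable (fun a => f a + g a) := Primrec.nat_add.to_comp.comp hf hg

@[fun_prop]
theorem computable_mul' {f g : α → ℕ} (hf : Computable f) (hg : Computable g) :
    Computable (fun a => f a * g a) := Primrec.nat_mul.to_comp.comp hf hg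

@[fun_prop]
theorem computable_div' {f g : α → ℕ} (hf : Computable f) (hg : Computable g) :
    Computable (fun a => f a / g a) := Primrec.nat_div.to_comp.comp hf hg

@[fun_prop]
theorem computable_mod' {f g : α → ℕ} (hf : Computable f) (hg : Computable g) :
    Computable (fun a => f a % g a) := Primrec.nat_mod.to_comp.comp hf hg

@[fun_prop]
theorem computable_pow' {f g : α → ℕ} (hf : Computable f) (hg : Computable g) :
    Computable (fun a => f a ^ g a) :=
  (Primrec₂.unpaired'.1 Nat.Primrec.pow).to_comp.comp hf hg

theorem computable_decide_eq [DecidableEq β] {f g : α → β} (hf : Computable f)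
    (hg : Computable g) : Computable (fun a => decide (f a = g a)) :=
  (Primrec.eq (α := β)).decide.to_comp.comp hf hg

@[fun_prop]
theorem computable_beq' [BEq β] [LawfulBEq β] {f g : α → β} (hf : Computable f)
    (hg : Computable g) : Computable (fun a => f a == g a) := by
  classical
  exact (computable_decide_eq hf hg).of_eq fun a => by
    rw [Bool.eq_iff_iff, decide_eq_true_eq, beq_iff_eq]

@[fun_prop]
theorem computable_decide_lt {f g : α → ℕ} (hf : Computable f) (hg : Computable g) :
    Computable (fun a => decide (f a < g a)) :=
  Primrec.nat_lt.decide.to_comp.comp hf hg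

@[fun_prop]
theorem computable_and' {f g : α → Bool} (hf : Computable f) (hg : Computable g) :
    Computable (fun a => (f a && g a)) := Primrec.and.to_comp.comp hf hg

@[fun_prop]
theorem computable_or' {f g : α → Bool} (hf : Computable f) (hg : Computable g) :
    Computable (fun a => (f a || g a)) := Primrec.or.to_comp.comp hf hg

@[fun_prop]
theorem computable_not' {f : α → Bool} (hf : Computable f) : Computable (fun a => !f a) :=
  Primrec.not.to_comp.comp hf

@[fun_prop]
theorem computable_cond' {c : α → Bool} {f g : α → β} (hc : Computable c) (hf : Computable f)
    (hg : Computable g) : Computable (fun a => cond (c a) (f a) (g a)) := Computable.cond hc hf hg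

@[fun_prop]
theorem computable_testBit' {f g : α → ℕ} (hf : Computable f) (hg : Computable g) :
    Computable (fun a => (f a).testBit (g a)) := by
  have : Computable fun a => (f a / 2 ^ g a % 2 == 1) := by fun_prop
  exact this.of_eq fun a => by
    rw [Nat.testBit_eq_decide_div_mod_eq]
    rfl

@[fun_prop]
theorem computable_encode' {f : α → β} (hf : Computable f) :
    Computable (fun a => Encodable.encode (f a)) := Computable.encode.comp hf

@[fun_prop]
theorem computable_decode' {f : α → ℕ} (hf : Computable f) :
    Computable (fun a => (Encodable.decode (f a) : Option β)) := Computable.decode.comp hf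

@[fun_prop]
theorem computable_some' {f : α → β} (hf : Computable f) :
    Computable (fun a => some (f a)) := Computable.option_some.comp hf

@[fun_prop]
theorem computable_optionGetD' {f : α → Option β} {g : α → β} (hf : Computable f)
    (hg : Computable g) : Computable (fun a => (f a).getD (g a)) := Computable.option_getD hf hg

@[fun_prop]
theorem computable_unpair' {f : α → ℕ} (hf : Computable f) :
    Computable (fun a => (f a).unpair) := Computable.unpair.comp hf

@[fun_prop]
theorem computable_length' {f : α → List β} (hf : Computable f) :
    Computable (fun a => (f a).length) := Computable.list_length.comp hf

@[fun_prop]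
theorem computable_cons' {f : α → β} {g : α → List β} (hf : Computable f) (hg : Computable g) :
    Computable (fun a => f a :: g a) := Computable.list_cons.comp hf hg

@[fun_prop]
theorem computable_append' {f g : α → List β} (hf : Computable f) (hg : Computable g) :
    Computable (fun a => f a ++ g a) := Computable.list_append.comp hf hg

@[fun_prop]
theorem computable_getD' {f : α → List β} {g : α → ℕ} {h : α → β} (hf : Computable f)
    (hg : Computable g) (hh : Computable h) : Computable (fun a => (f a).getD (g a) (h a)) :=
  (Computable.option_getD (Computable.list_getElem?.comp hf hg) hh).of_eq fun a => by simp

@[fun_prop]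
theorem computable_nat_rec' {N : α → ℕ} {g : α → β} {h : α → ℕ → β → β} (hN : Computable N)
    (hg : Computable g) (hh : Computable fun p : α × ℕ × β => h p.1 p.2.1 p.2.2) :
    Computable (fun a => (Nat.rec (g a) (h a) (N a) : β)) :=
  Computable.nat_rec (h := fun a p => h a p.1 p.2) hN hg hh

theorem computable_map_range {N : α → ℕ} {f : α → ℕ → β} (hN : Computable N)
    (hf : Computable (fun p : α × ℕ => f p.1 p.2)) :
    Computable (fun a => (List.range (N a)).map (f a)) := by
  have : Computable fun a => (Nat.rec [] (fun i l => l ++ [f a i]) (N a) : List β) := by fun_prop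
  refine this.of_eq fun a => ?_
  induction N a with
  | zero => rfl
  | succ n ih => simp only [ih, List.range_succ, List.map_append, List.map_cons, List.map_nil]

theorem computable_map [Inhabited β] {l : α → List β} {f : α → β → γ} (hl : Computable l)
    (hf : Computable (fun p : α × β => f p.1 p.2)) : Computable (fun a => (l a).map (f a)) := by
  have : Computable fun a => (List.range (l a).length).map fun i => f a ((l a).getD i default) :=
    computable_map_range (by fun_prop) (by fun_prop)
  refine this.of_eq fun a => ?_
  refine List.ext_getElem (by simp) fun i h1 h2 => ?_
  simp at h1
  simp [List.getD_eq_getElem?_getD, h1]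

/-- The bounded quantifier `∀ i < n, f i`. -/
def allBelow (n : ℕ) (f : ℕ → Bool) : Bool := Nat.rec true (fun i b => b && f i) n

theorem allBelow_eq_true {n : ℕ} {f : ℕ → Bool} :
    allBelow n f = true ↔ ∀ i < n, f i = true := by
  induction n with
  | zero => simp [allBelow]
  | succ n ih =>
    rw [Nat.forall_lt_succ_right, ← ih]
    exact Bool.and_eq_true_iff

@[fun_prop]
theorem computable_allBelow {N : α → ℕ} {f : α → ℕ → Bool} (hN : Computable N)
    (hf : Computable (fun p : α × ℕ => f p.1 p.2)) :
    Computable (fun a => allBelow (N a) (f a)) := by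
  unfold allBelow
  fun_prop

@[fun_prop]
theorem computable_contains' {f : α → ℕ} {g : α → List ℕ} (hf : Computable f)
    (hg : Computable g) : Computable fun a => (g a).contains (f a) := by
  have h : Computable fun a => (g a).idxOf (f a) := Primrec.list_idxOf.to_comp.comp hf hg
  have : Computable fun a => decide ((g a).idxOf (f a) < (g a).length) := by fun_prop
  exact this.of_eq fun a => by
    rw [Bool.eq_iff_iff, decide_eq_true_eq, List.idxOf_lt_length_iff, List.contains_iff_mem]

end ComputableCalculus

/-! ### Dyadic complex numbers -/

/-- Codes of dyadic complex numbers: `((a, b), (c, d)), e` stands for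
`((a - b) + (c - d) * I) / 2 ^ e`. -/
abbrev Dyadic : Type := ((ℕ × ℕ) × (ℕ × ℕ)) × ℕ

namespace Dyadic

/-- Codes are not normalised: signs are differences of naturals and denominators are never reduced,
so the ring operations are plain expressions in natural-number arithmetic and their computability is
automatic. -/
def val (x : Dyadic) : ℂ :=
  (((x.1.1.1 : ℂ) - x.1.1.2) + ((x.1.2.1 : ℂ) - x.1.2.2) * Complex.I) / 2 ^ x.2

def add (x y : Dyadic) : Dyadic :=
  (((x.1.1.1 * 2 ^ y.2 + y.1.1.1 * 2 ^ x.2, x.1.1.2 * 2 ^ y.2 + y.1.1.2 * 2 ^ x.2),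
    (x.1.2.1 * 2 ^ y.2 + y.1.2.1 * 2 ^ x.2, x.1.2.2 * 2 ^ y.2 + y.1.2.2 * 2 ^ x.2)), x.2 + y.2)

def mul (x y : Dyadic) : Dyadic :=
  (((x.1.1.1 * y.1.1.1 + x.1.1.2 * y.1.1.2 + (x.1.2.1 * y.1.2.2 + x.1.2.2 * y.1.2.1),
      x.1.1.1 * y.1.1.2 + x.1.1.2 * y.1.1.1 + (x.1.2.1 * y.1.2.1 + x.1.2.2 * y.1.2.2)),
    (x.1.1.1 * y.1.2.1 + x.1.1.2 * y.1.2.2 + (x.1.2.1 * y.1.1.1 + x.1.2.2 * y.1.1.2),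
      x.1.1.1 * y.1.2.2 + x.1.1.2 * y.1.2.1 + (x.1.2.1 * y.1.1.2 + x.1.2.2 * y.1.1.1))), x.2 + y.2)

def conj (x : Dyadic) : Dyadic := ((x.1.1, (x.1.2.2, x.1.2.1)), x.2)

def zero : Dyadic := (((0, 0), (0, 0)), 0)

def sum (f : ℕ → Dyadic) (n : ℕ) : Dyadic := Nat.rec zero (fun i s => add s (f i)) n

/-- A number `m` with `‖val x‖ + 1 ≤ 2 ^ m`. -/
def size (x : Dyadic) : ℕ := x.1.1.1 + x.1.1.2 + x.1.2.1 + x.1.2.2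

theorem val_add (x y : Dyadic) : (add x y).val = x.val + y.val := by
  simp only [val, add]
  push_cast
  field_simp
  ring

theorem val_mul (x y : Dyadic) : (mul x y).val = x.val * y.val := by
  simp only [val, mul]
  push_cast
  rw [div_mul_div_comm, ← pow_add]
  congr 1
  linear_combination (-((x.1.2.1 : ℂ) - x.1.2.2) * ((y.1.2.1 : ℂ) - y.1.2.2)) * Complex.I_sq

theorem val_conj (x : Dyadic) : (conj x).val = star x.val := by
  simp only [val, conj]
  simp only [star_div₀, star_add, star_sub, star_mul', star_pow, Complex.star_def, Complex.conj_I,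
    map_natCast, Complex.conj_ofNat]
  ring

theorem val_zero : zero.val = 0 := by simp [val, zero]

theorem val_sum (f : ℕ → Dyadic) (n : ℕ) : (sum f n).val = ∑ i ∈ Finset.range n, (f i).val := by
  induction n with
  | zero => simpa [sum] using val_zero
  | succ n ih =>
    rw [Finset.sum_range_succ, ← ih, ← val_add]
    rfl

theorem norm_val_le (x : Dyadic) : ‖x.val‖ + 1 ≤ 2 ^ x.size := by
  have h1 : ‖x.val‖ ≤ x.size := by
    rw [val, norm_div, norm_pow, Complex.norm_ofNat]
    refine (div_le_self (norm_nonneg _) (one_le_pow₀ (by norm_num))).trans ?_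
    refine (norm_add_le _ _).trans ?_
    rw [norm_mul, Complex.norm_I, mul_one]
    have h2 := norm_sub_le (x.1.1.1 : ℂ) x.1.1.2
    have h3 := norm_sub_le (x.1.2.1 : ℂ) x.1.2.2
    simp only [Complex.norm_natCast] at h2 h3
    simp only [size]
    push_cast
    linarith
  have h2 : x.size + 1 ≤ 2 ^ x.size := Nat.lt_two_pow_self
  have h3 : ((x.size + 1 : ℕ) : ℝ) ≤ ((2 ^ x.size : ℕ) : ℝ) := Nat.cast_le.2 h2
  push_cast at h3
  linarith

variable {α : Type} [Primcodable α]

@[fun_prop]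
theorem computable_add {f g : α → Dyadic} (hf : Computable f) (hg : Computable g) :
    Computable (fun a => add (f a) (g a)) := by
  unfold add
  fun_prop

@[fun_prop]
theorem computable_mul {f g : α → Dyadic} (hf : Computable f) (hg : Computable g) :
    Computable (fun a => mul (f a) (g a)) := by
  unfold mul
  fun_prop

@[fun_prop]
theorem computable_conj {f : α → Dyadic} (hf : Computable f) :
    Computable (fun a => conj (f a)) := by
  unfold conj
  fun_prop

@[fun_prop]
theorem computable_size {f : α → Dyadic} (hf : Computable f) :
    Computable (fun a => size (f a)) := by
  unfold size
  fun_prop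

@[fun_prop]
theorem computable_sum {f : α → ℕ → Dyadic} {N : α → ℕ}
    (hf : Computable fun p : α × ℕ => f p.1 p.2) (hN : Computable N) :
    Computable (fun a => sum (f a) (N a)) := by
  unfold sum
  fun_prop

end Dyadic

/-! ### Computable complex-valued functions -/

/-- A complex-valued function with computable dyadic approximations. -/
def IsComputableFun {α : Type} [Primcodable α] (F : α → ℂ) : Prop :=
  ∃ f : α × ℕ → Dyadic, Computable f ∧ ∀ a k, ‖F a - (f (a, k)).val‖ ≤ (1 / 2) ^ k

namespace IsComputableFun

variable {α β : Type} [Primcodable α] [Primcodable β] {F G : α → ℂ}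

theorem of_eq (hF : IsComputableFun F) (h : ∀ a, F a = G a) : IsComputableFun G :=
  (funext h : F = G) ▸ hF

theorem comp {H : β → ℂ} (hH : IsComputableFun H) {g : α → β} (hg : Computable g) :
    IsComputableFun fun a => H (g a) := by
  obtain ⟨f, hf, hfe⟩ := hH
  exact ⟨fun p => f (g p.1, p.2), by fun_prop, fun a k => hfe (g a) k⟩

theorem of_dyadic {f : α → Dyadic} (hf : Computable f) : IsComputableFun fun a => (f a).val :=
  ⟨fun p => f p.1, by fun_prop, fun a k => by simp⟩

theorem of_nat {f : α → ℕ} (hf : Computable f) : IsComputableFun fun a => (f a : ℂ) :=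
  (of_dyadic (f := fun a => (((f a, 0), (0, 0)), 0)) (by fun_prop)).of_eq fun a => by
    simp [Dyadic.val]

theorem neg_nat {f : α → ℕ} (hf : Computable f) : IsComputableFun fun a => -(f a : ℂ) :=
  (of_dyadic (f := fun a => (((0, f a), (0, 0)), 0)) (by fun_prop)).of_eq fun a => by
    simp [Dyadic.val]

theorem inv_two_pow {f : α → ℕ} (hf : Computable f) :
    IsComputableFun fun a => ((2 : ℂ) ^ f a)⁻¹ :=
  (of_dyadic (f := fun a => (((1, 0), (0, 0)), f a)) (by fun_prop)).of_eq fun a => by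
    simp [Dyadic.val]

theorem add (hF : IsComputableFun F) (hG : IsComputableFun G) :
    IsComputableFun fun a => F a + G a := by
  obtain ⟨f, hf, hfe⟩ := hF
  obtain ⟨g, hg, hge⟩ := hG
  refine ⟨fun p => Dyadic.add (f (p.1, p.2 + 1)) (g (p.1, p.2 + 1)), by fun_prop, fun a k => ?_⟩
  rw [Dyadic.val_add, add_sub_add_comm]
  refine (norm_add_le _ _).trans ((add_le_add (hfe a (k + 1)) (hge a (k + 1))).trans ?_)
  rw [pow_succ]
  linarith

theorem conj (hF : IsComputableFun F) : IsComputableFun fun a => star (F a) := by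
  obtain ⟨f, hf, hfe⟩ := hF
  refine ⟨fun p => Dyadic.conj (f p), by fun_prop, fun a k => ?_⟩
  rw [Dyadic.val_conj, ← star_sub, norm_star]
  exact hfe a k

theorem mul (hF : IsComputableFun F) (hG : IsComputableFun G) :
    IsComputableFun fun a => F a * G a := by
  obtain ⟨f, hf, hfe⟩ := hF
  obtain ⟨g, hg, hge⟩ := hG
  -- The approximations at precision 0 bound `‖F a‖` and `‖G a‖` by powers of two with these
  -- exponents; the final 2 pays for the factor 4 in `q3`.
  let m : α → ℕ := fun a => (f (a, 0)).size + (g (a, 0)).size + 2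
  have hm : Computable m := by
    simp only [m]
    fun_prop
  refine ⟨fun p => Dyadic.mul (f (p.1, p.2 + m p.1)) (g (p.1, p.2 + m p.1)), by fun_prop,
    fun a k => ?_⟩
  have hF' : ‖F a‖ ≤ 2 ^ (f (a, 0)).size := by
    have h1 := hfe a 0
    have h2 := Dyadic.norm_val_le (f (a, 0))
    have h3 := norm_sub_norm_le (F a) (f (a, 0)).val
    simp only [pow_zero] at h1
    linarith
  have hG' : ‖G a‖ ≤ 2 ^ (g (a, 0)).size := by
    have h1 := hge a 0
    have h2 := Dyadic.norm_val_le (g (a, 0))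
    have h3 := norm_sub_norm_le (G a) (g (a, 0)).val
    simp only [pow_zero] at h1
    linarith
  change ‖F a * G a - (Dyadic.mul (f (a, k + m a)) (g (a, k + m a))).val‖ ≤ _
  have h1 := hfe a (k + m a)
  have h2 := hge a (k + m a)
  generalize f (a, k + m a) = u at *
  generalize g (a, k + m a) = v at *
  rw [Dyadic.val_mul]
  have hδ0 : (0 : ℝ) ≤ (1 / 2) ^ (k + m a) := by positivity
  have hδ1 : ((1 : ℝ) / 2) ^ (k + m a) ≤ 1 := pow_le_one₀ (by norm_num) (by norm_num)
  have hv : ‖v.val‖ ≤ 2 ^ (g (a, 0)).size + 1 := by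
    have h3 := norm_sub_norm_le v.val (G a)
    rw [norm_sub_rev] at h3
    linarith
  have hδ : ((1 : ℝ) / 2) ^ (k + m a) * (2 ^ (f (a, 0)).size * 2 ^ (g (a, 0)).size * 4) =
      (1 / 2) ^ k := by
    simp only [m, pow_add, one_div, inv_pow]
    field_simp
    norm_num
  have e : F a * G a - u.val * v.val = F a * (G a - v.val) + (F a - u.val) * v.val := by ring
  rw [e]
  refine (norm_add_le _ _).trans ?_
  rw [norm_mul, norm_mul, ← hδ]
  have p1 : (1 : ℝ) ≤ 2 ^ (f (a, 0)).size := one_le_pow₀ (by norm_num)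
  have p2 : (1 : ℝ) ≤ 2 ^ (g (a, 0)).size := one_le_pow₀ (by norm_num)
  have q1 : ‖F a‖ * ‖G a - v.val‖ ≤ 2 ^ (f (a, 0)).size * (1 / 2) ^ (k + m a) :=
    mul_le_mul hF' h2 (norm_nonneg _) (by positivity)
  have q2 : ‖F a - u.val‖ * ‖v.val‖ ≤ (1 / 2) ^ (k + m a) * (2 ^ (g (a, 0)).size + 1) :=
    mul_le_mul h1 hv (norm_nonneg _) hδ0
  have q3 : (2 : ℝ) ^ (f (a, 0)).size + (2 ^ (g (a, 0)).size + 1) ≤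
      2 ^ (f (a, 0)).size * 2 ^ (g (a, 0)).size * 4 := by nlinarith
  nlinarith [mul_le_mul_of_nonneg_left q3 hδ0]

theorem neg (hF : IsComputableFun F) : IsComputableFun fun a => -F a :=
  ((neg_nat (Computable.const 1)).mul hF).of_eq fun a => by simp

theorem sub (hF : IsComputableFun F) (hG : IsComputableFun G) :
    IsComputableFun fun a => F a - G a :=
  (hF.add hG.neg).of_eq fun _ => (sub_eq_add_neg _ _).symm

theorem cond {c : α → Bool} (hc : Computable c) (hF : IsComputableFun F)
    (hG : IsComputableFun G) : IsComputableFun fun a => if c a = true then F a else G a := by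
  obtain ⟨f, hf, hfe⟩ := hF
  obtain ⟨g, hg, hge⟩ := hG
  refine ⟨fun p => _root_.cond (c p.1) (f p) (g p), by fun_prop, fun a k => ?_⟩
  by_cases h : c a = true
  · simpa [h] using hfe a k
  · simpa [h] using hge a k

theorem range_sum {H : α × ℕ → ℂ} (hH : IsComputableFun H) {N : α → ℕ} (hN : Computable N) :
    IsComputableFun fun a => ∑ i ∈ Finset.range (N a), H (a, i) := by
  obtain ⟨f, hf, hfe⟩ := hH
  -- `N` extra bits suffice for a sum of `N` terms because `N ≤ 2 ^ N`.
  refine ⟨fun p => Dyadic.sum (fun i => f ((p.1, i), p.2 + N p.1)) (N p.1), by fun_prop,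
    fun a k => ?_⟩
  rw [Dyadic.val_sum, ← Finset.sum_sub_distrib]
  refine (norm_sum_le _ _).trans ((Finset.sum_le_sum fun i _ => hfe (a, i) (k + N a)).trans ?_)
  rw [Finset.sum_const, Finset.card_range, nsmul_eq_mul, pow_add, mul_left_comm]
  refine mul_le_of_le_one_right (by positivity) ?_
  rw [one_div, inv_pow, ← div_eq_mul_inv]
  refine div_le_one_of_le₀ ?_ (by positivity)
  exact_mod_cast (Nat.lt_two_pow_self (n := N a)).le

theorem finset_sum {ι : Type*} (s : Finset ι) {H : ι → α → ℂ}
    (hH : ∀ i ∈ s, IsComputableFun (H i)) : IsComputableFun fun a => ∑ i ∈ s, H i a := by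
  classical
  induction s using Finset.induction_on with
  | empty => exact (of_nat (Computable.const 0)).of_eq fun a => by simp
  | insert i s hi ih =>
    simp only [Finset.sum_insert hi]
    exact (hH i (by simp)).add (ih fun j hj => hH j (by simp [hj]))

/-- Iterated multiplication of a vector by matrices. -/
theorem vec_rec {N : α → ℕ} (hN : Computable N) {A : α × ℕ × ℕ × ℕ → ℂ} (hA : IsComputableFun A)
    (hA1 : ∀ x, ‖A x‖ ≤ 1) {V : α → ℕ → ℕ → ℂ}
    (h0 : IsComputableFun fun p : α × ℕ => V p.1 0 p.2) (h01 : ∀ a y, ‖V a 0 y‖ ≤ 1)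
    (hV : ∀ a j y, V a (j + 1) y = ∑ z ∈ Finset.range (N a), A (a, j, y, z) * V a j z) :
    IsComputableFun fun p : α × ℕ × ℕ =>
      if decide (p.2.2 < N p.1) = true then V p.1 p.2.1 p.2.2 else 0 := by
  obtain ⟨f, hf, hfe⟩ := hA
  obtain ⟨g, hg, hge⟩ := h0
  -- The whole iteration is run on lists of dyadic numbers, with every input taken at one fixed
  -- precision `K`.
  let W : α → ℕ → ℕ → List Dyadic := fun a K j =>
    Nat.rec ((List.range (N a)).map fun y => g ((a, y), K))
      (fun j L => (List.range (N a)).map fun y =>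
        Dyadic.sum (fun z => Dyadic.mul (f ((a, j, y, z), K)) (L.getD z Dyadic.zero)) (N a)) j
  have hW : Computable fun p : α × ℕ × ℕ => W p.1 p.2.1 p.2.2 := by
    refine computable_nat_rec'
      (g := fun p : α × ℕ × ℕ => (List.range (N p.1)).map fun y => g ((p.1, y), p.2.1))
      (h := fun p j L => (List.range (N p.1)).map fun y =>
        Dyadic.sum (fun z => Dyadic.mul (f ((p.1, j, y, z), p.2.1)) (L.getD z Dyadic.zero)) (N p.1))
      (by fun_prop) ?_ ?_
    · exact computable_map_range (by fun_prop) (by fun_prop)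
    · exact computable_map_range (by fun_prop) (by fun_prop)
  have hVb : ∀ a j y, ‖V a j y‖ ≤ (3 * N a + 1) ^ j := by
    intro a j
    induction j with
    | zero => simpa using h01 a
    | succ j ih =>
      intro y
      rw [hV]
      refine (norm_sum_le _ _).trans ((Finset.sum_le_sum (g := fun _ => (3 * N a + 1 : ℝ) ^ j)
        fun z _ => ?_).trans ?_)
      · rw [norm_mul]
        exact (mul_le_of_le_one_left (norm_nonneg _) (hA1 _)).trans (ih z)
      · rw [Finset.sum_const, Finset.card_range, nsmul_eq_mul, pow_succ, mul_comm]
        refine mul_le_mul_of_nonneg_left ?_ (by positivity)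
        linarith [(Nat.cast_nonneg (N a) : (0 : ℝ) ≤ N a)]
  have hVb' : ∀ a j, (N a : ℝ) * 1 ≤ N a * (3 * N a + 1) ^ j := fun a j =>
    mul_le_mul_of_nonneg_left (one_le_pow₀ (by
      linarith [(Nat.cast_nonneg (N a) : (0 : ℝ) ≤ N a)])) (Nat.cast_nonneg _)
  have key : ∀ a K j y, y < N a →
      ‖V a j y - ((W a K j).getD y Dyadic.zero).val‖ ≤ (1 / 2) ^ K * (3 * N a + 1) ^ j := by
    intro a K j
    induction j with
    | zero =>
      intro y hy
      have : (W a K 0).getD y Dyadic.zero = g ((a, y), K) := by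
        simp [W, List.getD_eq_getElem?_getD, hy]
      rw [this]
      simpa using hge (a, y) K
    | succ j ih =>
      intro y hy
      have : (W a K (j + 1)).getD y Dyadic.zero =
          Dyadic.sum (fun z => Dyadic.mul (f ((a, j, y, z), K)) ((W a K j).getD z Dyadic.zero))
            (N a) := by
        simp [W, List.getD_eq_getElem?_getD, hy]
      rw [this, hV, Dyadic.val_sum, ← Finset.sum_sub_distrib]
      refine (norm_sum_le _ _).trans ((Finset.sum_le_sum
        (g := fun _ => (1 / 2 : ℝ) ^ K * (3 * (3 * N a + 1 : ℝ) ^ j)) fun z hz => ?_).trans ?_)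
      · have h1 := hfe (a, j, y, z) K
        have h2 := ih z (Finset.mem_range.1 hz)
        have h3 := hVb a j z
        have h4 := hA1 (a, j, y, z)
        generalize f ((a, j, y, z), K) = u at *
        generalize (W a K j).getD z Dyadic.zero = v at *
        have e : A (a, j, y, z) * V a j z - (Dyadic.mul u v).val =
            (A (a, j, y, z) - u.val) * V a j z + u.val * (V a j z - v.val) := by
          rw [Dyadic.val_mul]
          ring
        have hu : ‖u.val‖ ≤ 2 := by
          have h5 := norm_sub_norm_le u.val (A (a, j, y, z))
          rw [norm_sub_rev] at h5
          have h6 : ((1 : ℝ) / 2) ^ K ≤ 1 := pow_le_one₀ (by norm_num) (by norm_num)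
          linarith
        rw [e]
        refine (norm_add_le _ _).trans ?_
        rw [norm_mul, norm_mul]
        have h7 := mul_le_mul h1 h3 (norm_nonneg _) (by positivity)
        have h8 := mul_le_mul hu h2 (norm_nonneg _) (by positivity)
        linarith
      · rw [Finset.sum_const, Finset.card_range, nsmul_eq_mul, pow_succ]
        have : (0 : ℝ) ≤ (1 / 2) ^ K * (3 * N a + 1) ^ j := by positivity
        nlinarith
  -- The error bound `key` grows by a factor 3N + 1 per step, and 3N + 1 extra bits per step
  -- outweigh it.
  refine ⟨fun p => _root_.cond (decide (p.1.2.2 < N p.1.1))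
    ((W p.1.1 (p.2 + (3 * N p.1.1 + 1) * p.1.2.1) p.1.2.1).getD p.1.2.2 Dyadic.zero) Dyadic.zero,
    by fun_prop, ?_⟩
  rintro ⟨a, j, y⟩ k
  by_cases hy : y < N a
  · simp only [hy, decide_true, if_true, cond_true]
    refine (key a _ j y hy).trans ?_
    rw [pow_add, mul_assoc]
    refine mul_le_of_le_one_right (by positivity) ?_
    rw [pow_mul, ← mul_pow]
    refine pow_le_one₀ (by positivity) ?_
    rw [one_div, inv_pow, inv_mul_eq_div]
    refine div_le_one_of_le₀ ?_ (by positivity)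
    exact_mod_cast (Nat.lt_two_pow_self (n := 3 * N a + 1)).le
  · simp [hy, Dyadic.val_zero]

theorem const {z : ℂ} (h1 : IsComputableReal z.re) (h2 : IsComputableReal z.im) :
    IsComputableFun fun _ : α => z := by
  obtain ⟨f, hf, hfe⟩ := h1
  obtain ⟨g, hg, hge⟩ := h2
  -- The encoding of `ℤ` sends n to 2n and -(n + 1) to 2n + 1, so the parity of the code is the
  -- sign.
  have hnat : Computable Int.toNat := by
    have : Computable fun x : ℤ => _root_.cond (Encodable.encode x % 2 == 0)
      (Encodable.encode x / 2) 0 := by fun_prop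
    refine this.of_eq fun x => ?_
    cases x with
    | ofNat n =>
      have : Encodable.encode (n : ℤ) = 2 * n := rfl
      simp [this]
    | negSucc n =>
      have : Encodable.encode (Int.negSucc n) = 2 * n + 1 := rfl
      simp [this, Nat.add_mod]
  have hneg : Computable fun x : ℤ => (-x).toNat := by
    have : Computable fun x : ℤ => _root_.cond (Encodable.encode x % 2 == 0) 0
      (Encodable.encode x / 2 + 1) := by fun_prop
    refine this.of_eq fun x => ?_
    cases x with
    | ofNat n =>
      have : Encodable.encode (n : ℤ) = 2 * n := rfl
      simp [this]
    | negSucc n =>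
      have : Encodable.encode (Int.negSucc n) = 2 * n + 1 := rfl
      simp [this, Nat.add_mod]
      omega
  refine ⟨fun p => ((((f (p.2 + 1)).toNat, (-f (p.2 + 1)).toNat),
    ((g (p.2 + 1)).toNat, (-g (p.2 + 1)).toNat)), p.2 + 1), ?_, fun a k => ?_⟩
  · have h1 : Computable fun p : α × ℕ => (-f (p.2 + 1)).toNat :=
      hneg.comp (f := fun x : ℤ => (-x).toNat) (g := fun p : α × ℕ => f (p.2 + 1)) (by fun_prop)
    have h2 : Computable fun p : α × ℕ => (-g (p.2 + 1)).toNat :=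
      hneg.comp (f := fun x : ℤ => (-x).toNat) (g := fun p : α × ℕ => g (p.2 + 1)) (by fun_prop)
    fun_prop
  · have hc : ∀ x : ℤ, ((x.toNat : ℂ) - ((-x).toNat : ℂ)) = ((x : ℝ) : ℂ) := fun x => by
      have := Int.toNat_sub_toNat_neg x
      exact_mod_cast congrArg (Int.cast : ℤ → ℂ) this
    have h1 := hfe (k + 1)
    have h2 := hge (k + 1)
    simp only [Dyadic.val]
    rw [hc, hc]
    have e : z - (((f (k + 1) : ℝ) : ℂ) + ((g (k + 1) : ℝ) : ℂ) * Complex.I) / 2 ^ (k + 1) =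
        ((z.re - f (k + 1) / 2 ^ (k + 1) : ℝ) : ℂ) +
          ((z.im - g (k + 1) / 2 ^ (k + 1) : ℝ) : ℂ) * Complex.I := by
      conv_lhs => rw [← Complex.re_add_im z]
      push_cast
      ring
    rw [e]
    refine (norm_add_le _ _).trans ?_
    rw [norm_mul, Complex.norm_I, mul_one, Complex.norm_real, Complex.norm_real, Real.norm_eq_abs,
      Real.norm_eq_abs]
    refine (add_le_add h1 h2).trans (le_of_eq ?_)
    rw [one_div, one_div, inv_pow, pow_succ]
    field_simp
    norm_num

/-- Positivity of the real part of a computable function is semidecidable. -/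
theorem exists_test (hF : IsComputableFun F) : ∃ T : α × ℕ → Bool, Computable T ∧
    ∀ a, 0 < (F a).re ↔ ∃ k, T (a, k) = true := by
  obtain ⟨f, hf, hfe⟩ := hF
  have hre : ∀ x : Dyadic, x.val.re = ((x.1.1.1 : ℝ) - x.1.1.2) / 2 ^ x.2 := fun x => by
    have : ((2 : ℂ) ^ x.2) = ((2 ^ x.2 : ℝ) : ℂ) := by push_cast; rfl
    rw [Dyadic.val, this, Complex.div_ofReal_re]
    simp
  -- The test asks whether the approximation exceeds its own error 2^-k; denominators are cleared to
  -- leave a comparison of naturals.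
  refine ⟨fun p => decide ((f p).1.1.2 * 2 ^ p.2 + 2 ^ (f p).2 < (f p).1.1.1 * 2 ^ p.2),
    by fun_prop, fun a => ?_⟩
  have hT : ∀ k, decide ((f (a, k)).1.1.2 * 2 ^ k + 2 ^ (f (a, k)).2 <
      (f (a, k)).1.1.1 * 2 ^ k) = true ↔ (1 / 2 : ℝ) ^ k < (f (a, k)).val.re := fun k => by
    rw [decide_eq_true_eq, ← Nat.cast_lt (α := ℝ), hre, lt_div_iff₀ (by positivity), one_div,
      inv_pow, inv_mul_eq_div, div_lt_iff₀ (by positivity)]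
    push_cast
    constructor <;> intro h <;> linarith
  have hd : ∀ k, |(F a).re - (f (a, k)).val.re| ≤ (1 / 2) ^ k := fun k => by
    rw [← Complex.sub_re]
    exact (Complex.abs_re_le_norm _).trans (hfe a k)
  simp only [hT]
  constructor
  · intro h
    obtain ⟨k, hk⟩ := exists_pow_lt_of_lt_one (half_pos h) (by norm_num : (1 / 2 : ℝ) < 1)
    exact ⟨k, by linarith [(abs_le.1 (hd k)).2]⟩
  · rintro ⟨k, hk⟩
    linarith [(abs_le.1 (hd k)).1]

end IsComputableFun

/-! ### Circuits as lists of numbers -/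

/-- Circuits without the constraints on gates and wires: the number of qubits and a list of pairs
of a gate index and a list of wires. -/
abbrev RawCircuit : Type := ℕ × List (ℕ × List ℕ)

def Circuit.raw {B : GateSet} {n : ℕ} (C : Circuit B n) : RawCircuit :=
  (n, C.map fun g => ((g.gate : ℕ), List.ofFn fun i => (g.wires i : ℕ)))

/-- The matrix entries of the gates, in terms of lists of bits. -/
def gateEntry (B : GateSet) (t : ℕ × List Bool × List Bool) : ℂ :=
  ∑ u : Σ g : Fin B.size, (Fin (B.arity g) → Bool) × (Fin (B.arity g) → Bool),
    if decide (t = ((u.1 : ℕ), List.ofFn u.2.1, List.ofFn u.2.2)) = true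
      then (B.gate u.1 : Op (B.arity u.1)) u.2.1 u.2.2 else 0

theorem gateIndex_injective (B : GateSet) : Function.Injective
    fun u : Σ g : Fin B.size, (Fin (B.arity g) → Bool) × (Fin (B.arity g) → Bool) =>
      ((u.1 : ℕ), List.ofFn u.2.1, List.ofFn u.2.2) := by
  rintro ⟨g, x, y⟩ ⟨g', x', y'⟩ h
  simp only [Prod.mk.injEq] at h
  obtain ⟨h1, h2, h3⟩ := h
  obtain rfl := Fin.ext h1
  rw [List.ofFn_injective h2, List.ofFn_injective h3]

theorem gateEntry_ofFn (B : GateSet) (g : Fin B.size) (x y : Fin (B.arity g) → Bool) :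
    gateEntry B ((g : ℕ), List.ofFn x, List.ofFn y) = (B.gate g : Op (B.arity g)) x y := by
  rw [gateEntry, Finset.sum_eq_single ⟨g, x, y⟩]
  · simp
  · intro u _ hu
    rw [if_neg]
    rw [decide_eq_true_eq]
    exact fun h => hu (gateIndex_injective B h.symm)
  · simp

theorem norm_gateEntry_le (B : GateSet) (t : ℕ × List Bool × List Bool) :
    ‖gateEntry B t‖ ≤ 1 := by
  by_cases h : ∃ u : Σ g : Fin B.size, (Fin (B.arity g) → Bool) × (Fin (B.arity g) → Bool),
      t = ((u.1 : ℕ), List.ofFn u.2.1, List.ofFn u.2.2)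
  · obtain ⟨u, rfl⟩ := h
    rw [gateEntry_ofFn]
    exact entry_norm_bound_of_unitary (B.gate u.1).2 _ _
  · rw [gateEntry, Finset.sum_eq_zero]
    · simp
    · intro u _
      rw [if_neg]
      rw [decide_eq_true_eq]
      exact fun hu => h ⟨u, hu⟩

theorem isComputableFun_gateEntry {B : GateSet} (hB : B.HasComputableAmplitudes) :
    IsComputableFun (gateEntry B) := by
  refine IsComputableFun.finset_sum _ fun u _ => ?_
  refine IsComputableFun.cond (computable_decide_eq Computable.id (Computable.const _))
    (IsComputableFun.const (hB _ _ _).1 (hB _ _ _).2) ?_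
  exact (IsComputableFun.of_nat (Computable.const 0)).of_eq fun a => by simp

/-- The matrix entries of the `j`-th step of a circuit. Basis states are numbers below `2 ^ n`. -/
def stepEntry (B : GateSet) (x : RawCircuit × ℕ × ℕ × ℕ) : ℂ :=
  if allBelow x.1.1 (fun i => (x.1.2.getD x.2.1 (0, [])).2.contains i ||
    (x.2.2.1.testBit i == x.2.2.2.testBit i)) = true
  then gateEntry B ((x.1.2.getD x.2.1 (0, [])).1,
    (x.1.2.getD x.2.1 (0, [])).2.map fun i => x.2.2.1.testBit i,
    (x.1.2.getD x.2.1 (0, [])).2.map fun i => x.2.2.2.testBit i)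
  else 0

theorem norm_stepEntry_le (B : GateSet) (x : RawCircuit × ℕ × ℕ × ℕ) : ‖stepEntry B x‖ ≤ 1 := by
  unfold stepEntry
  split_ifs
  · exact norm_gateEntry_le B _
  · simp

theorem isComputableFun_stepEntry {B : GateSet} (hB : B.HasComputableAmplitudes) :
    IsComputableFun (stepEntry B) := by
  refine IsComputableFun.cond (by fun_prop) ?_
    ((IsComputableFun.of_nat (Computable.const 0)).of_eq fun a => by simp)
  refine (isComputableFun_gateEntry hB).comp (g := fun x : RawCircuit × ℕ × ℕ × ℕ =>
    ((x.1.2.getD x.2.1 (0, [])).1, (x.1.2.getD x.2.1 (0, [])).2.map (fun i => x.2.2.1.testBit i),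
      (x.1.2.getD x.2.1 (0, [])).2.map (fun i => x.2.2.2.testBit i))) ?_
  have h1 : Computable fun x : RawCircuit × ℕ × ℕ × ℕ =>
      (x.1.2.getD x.2.1 (0, [])).2.map fun i => x.2.2.1.testBit i :=
    computable_map (by fun_prop) (by fun_prop)
  have h2 : Computable fun x : RawCircuit × ℕ × ℕ × ℕ =>
      (x.1.2.getD x.2.1 (0, [])).2.map fun i => x.2.2.2.testBit i :=
    computable_map (by fun_prop) (by fun_prop)
  fun_prop

/-- The state after the first `j` steps of a circuit. -/
def stateVec (B : GateSet) (S : RawCircuit) : ℕ → ℕ → ℂ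
  | 0, y => if (y == 0) = true then 1 else 0
  | j + 1, y => ∑ z ∈ Finset.range (2 ^ S.1), stepEntry B (S, j, y, z) * stateVec B S j z

/-- The amplitudes of the output of a circuit. -/
def amplitude (B : GateSet) (p : RawCircuit × ℕ) : ℂ :=
  if decide (p.2 < 2 ^ p.1.1) = true then stateVec B p.1 p.1.2.length p.2 else 0

theorem isComputableFun_amplitude {B : GateSet} (hB : B.HasComputableAmplitudes) :
    IsComputableFun (amplitude B) := by
  have h := IsComputableFun.vec_rec (N := fun S : RawCircuit => 2 ^ S.1) (V := stateVec B)
    (by fun_prop) (isComputableFun_stepEntry hB) (norm_stepEntry_le B) ?_ ?_ (fun a j y => rfl)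
  · exact h.comp (g := fun p : RawCircuit × ℕ => (p.1, p.1.2.length, p.2)) (by fun_prop)
  · refine IsComputableFun.cond (by fun_prop)
      ((IsComputableFun.of_nat (Computable.const 1)).of_eq fun a => by simp)
      ((IsComputableFun.of_nat (Computable.const 0)).of_eq fun a => by simp)
  · intro S y
    rw [stateVec]
    split_ifs <;> simp

/-- The basis state with a given number. -/
def basisBits (n y : ℕ) : Fin n → Bool := fun i => y.testBit i

theorem basisBits_bijective (n : ℕ) : Function.Bijective
    fun y : Fin (2 ^ n) => basisBits n y := by
  rw [Fintype.bijective_iff_injective_and_card]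
  refine ⟨fun y z h => Fin.ext (Nat.eq_of_testBit_eq fun i => ?_), by simp⟩
  by_cases hi : i < n
  · exact congrFun h ⟨i, hi⟩
  · have hp : 2 ^ n ≤ 2 ^ i := Nat.pow_le_pow_right (by norm_num) (not_lt.1 hi)
    rw [Nat.testBit_lt_two_pow (y.2.trans_le hp), Nat.testBit_lt_two_pow (z.2.trans_le hp)]

theorem sum_basisBits {M : Type*} [AddCommMonoid M] (n : ℕ) (f : (Fin n → Bool) → M) :
    ∑ y ∈ Finset.range (2 ^ n), f (basisBits n y) = ∑ x, f x := by
  rw [Finset.sum_range]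
  exact (basisBits_bijective n).sum_comp f

theorem basisBits_inj {n y z : ℕ} (hy : y < 2 ^ n) (hz : z < 2 ^ n)
    (h : basisBits n y = basisBits n z) : y = z :=
  congrArg Fin.val ((basisBits_bijective n).1 (a₁ := ⟨y, hy⟩) (a₂ := ⟨z, hz⟩) h)

/-- `Circuit.unitary` recurses on the head of the list, while `stateVec` follows the state in time
order, where the newest gate multiplies on the left. -/
theorem Circuit.unitary_concat {B : GateSet} {n : ℕ} (C : Circuit B n) (g : Step B n) :
    Circuit.unitary (C ++ [g]) =
      applyOn (B.gate g.gate : Op (B.arity g.gate)) g.wires * Circuit.unitary C := by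
  induction C with
  | nil => simp [Circuit.unitary]
  | cons h C ih =>
    change Circuit.unitary (C ++ [g]) * _ = _ * (Circuit.unitary C * _)
    rw [ih, mul_assoc]

theorem stepEntry_raw {B : GateSet} {n : ℕ} (C : Circuit B n) {j : ℕ} (hj : j < C.length)
    (y z : ℕ) : stepEntry B (C.raw, j, y, z) =
      applyOn (B.gate C[j].gate : Op (B.arity C[j].gate)) C[j].wires (basisBits n y)
        (basisBits n z) := by
  have hs : C.raw.2.getD j (0, []) =
      ((C[j].gate : ℕ), List.ofFn fun i => (C[j].wires i : ℕ)) := by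
    simp [Circuit.raw, List.getD_eq_getElem?_getD, hj]
  have hn : C.raw.1 = n := rfl
  rw [stepEntry]
  simp only [hs, hn, applyOn]
  have hiff : allBelow n (fun i => (List.ofFn fun i => (C[j].wires i : ℕ)).contains i ||
      (y.testBit i == z.testBit i)) = true ↔
      ∀ i : Fin n, i ∉ Set.range C[j].wires → basisBits n y i = basisBits n z i := by
    rw [allBelow_eq_true]
    simp only [Bool.or_eq_true, beq_iff_eq, List.contains_iff_mem, List.mem_ofFn']
    constructor
    · intro h i hi
      rcases h i i.2 with h' | h'
      · obtain ⟨k, hk⟩ := h'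
        exact absurd ⟨k, Fin.ext hk⟩ hi
      · exact h'
    · intro h i hi
      by_cases hr : (⟨i, hi⟩ : Fin n) ∈ Set.range C[j].wires
      · obtain ⟨k, hk⟩ := hr
        exact Or.inl ⟨k, congrArg Fin.val hk⟩
      · exact Or.inr (h ⟨i, hi⟩ hr)
  by_cases h : ∀ i : Fin n, i ∉ Set.range C[j].wires → basisBits n y i = basisBits n z i
  · rw [if_pos (hiff.2 h), if_pos h, List.map_ofFn, List.map_ofFn]
    exact gateEntry_ofFn B _ _ _
  · rw [if_neg (mt hiff.1 h), if_neg h]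

theorem stateVec_raw {B : GateSet} {n : ℕ} (C : Circuit B n) (j : ℕ) (hj : j ≤ C.length) (y : ℕ)
    (hy : y < 2 ^ n) :
    stateVec B C.raw j y = (Circuit.output (C.take j)).ofLp (basisBits n y) := by
  induction j generalizing y with
  | zero =>
    have h0 : basisBits n 0 = fun _ => false := funext fun i => by simp [basisBits]
    rw [stateVec]
    simp only [Circuit.output, List.take_zero, Circuit.unitary, Matrix.one_mulVec, ← h0,
      Pi.single_apply, beq_iff_eq]
    congr 1
    exact propext ⟨fun h => by rw [h], fun h => basisBits_inj hy (by positivity) h⟩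
  | succ j ih =>
    have hj' : j < C.length := hj
    rw [stateVec, List.take_succ_eq_append_getElem hj', Circuit.output, Circuit.unitary_concat,
      ← Matrix.mulVec_mulVec]
    have hn : C.raw.1 = n := rfl
    rw [hn]
    change _ = ∑ z, _ * _
    rw [← sum_basisBits]
    refine Finset.sum_congr rfl fun z hz => ?_
    rw [ih hj'.le z (Finset.mem_range.1 hz), stepEntry_raw C hj']
    rfl

theorem amplitude_raw {B : GateSet} {n : ℕ} (C : Circuit B n) {y : ℕ} (hy : y < 2 ^ n) :
    amplitude B (C.raw, y) = (Circuit.output C).ofLp (basisBits n y) := by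
  have h1 : C.raw.1 = n := rfl
  have h2 : C.raw.2.length = C.length := by simp [Circuit.raw]
  rw [amplitude]
  simp only [h1, h2, hy, decide_true, if_true]
  rw [stateVec_raw C _ le_rfl y hy, List.take_length]

/-- The inner product of the outputs of two circuits. -/
def rawInner (B : GateSet) (p : RawCircuit × RawCircuit) : ℂ :=
  ∑ y ∈ Finset.range (2 ^ p.1.1), star (amplitude B (p.1, y)) * amplitude B (p.2, y)

theorem isComputableFun_rawInner {B : GateSet} (hB : B.HasComputableAmplitudes) :
    IsComputableFun (rawInner B) := by
  have h := isComputableFun_amplitude hB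
  exact IsComputableFun.range_sum
    (H := fun q : (RawCircuit × RawCircuit) × ℕ =>
      star (amplitude B (q.1.1, q.2)) * amplitude B (q.1.2, q.2))
    ((h.comp (g := fun q : (RawCircuit × RawCircuit) × ℕ => (q.1.1, q.2)) (by fun_prop)).conj.mul
      (h.comp (g := fun q : (RawCircuit × RawCircuit) × ℕ => (q.1.2, q.2)) (by fun_prop)))
    (by fun_prop)

theorem rawInner_raw {B : GateSet} {n : ℕ} (C D : Circuit B n) :
    rawInner B (C.raw, D.raw) = inner ℂ (Circuit.output C) (Circuit.output D) := by
  have hn : C.raw.1 = n := rfl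
  rw [rawInner, PiLp.inner_apply, ← sum_basisBits]
  simp only [hn]
  refine Finset.sum_congr rfl fun y hy => ?_
  rw [amplitude_raw C (Finset.mem_range.1 hy), amplitude_raw D (Finset.mem_range.1 hy),
    RCLike.inner_apply, mul_comm]
  rfl

/-! ### Recognizing circuits -/

/-- The `getD` defaults never matter: each lookup is conjoined with a range check or ranges over
valid indices. For injectivity of the wiring it is enough to compare each wire with the earlier
ones. -/
def isCircuitStep (B : GateSet) (n : ℕ) (s : ℕ × List ℕ) : Bool :=
  decide (s.1 < B.size) && ((s.2.length == (List.ofFn B.arity).getD s.1 0) &&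
    allBelow s.2.length fun i => decide (s.2.getD i 0 < n) &&
      allBelow i fun k => !(s.2.getD i 0 == s.2.getD k 0))

def isCircuit (B : GateSet) (S : RawCircuit) : Bool :=
  allBelow S.2.length fun j => isCircuitStep B S.1 (S.2.getD j (0, []))

theorem computable_isCircuit (B : GateSet) : Computable (isCircuit B) := by
  unfold isCircuit isCircuitStep
  fun_prop

theorem isCircuitStep_iff {B : GateSet} {n : ℕ} {s : ℕ × List ℕ} :
    isCircuitStep B n s = true ↔
      ∃ g : Step B n, s = ((g.gate : ℕ), List.ofFn fun i => (g.wires i : ℕ)) := by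
  simp only [isCircuitStep, Bool.and_eq_true, decide_eq_true_eq, Bool.not_eq_true',
    beq_iff_eq, allBelow_eq_true, beq_eq_false_iff_ne, ne_eq]
  constructor
  · rintro ⟨h1, h2, h3⟩
    obtain ⟨g, l⟩ := s
    simp only at h1 h2 h3
    have h2' : l.length = B.arity ⟨g, h1⟩ := by
      simpa [List.getD_eq_getElem?_getD, h1] using h2
    have hget : ∀ (i : ℕ) (h : i < l.length), l.getD i 0 = l[i] := fun i h => by
      simp [List.getD_eq_getElem?_getD, h]
    have hlt : ∀ i : Fin (B.arity ⟨g, h1⟩), (i : ℕ) < l.length := fun i => h2'.symm ▸ i.2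
    let w : Fin (B.arity ⟨g, h1⟩) → Fin n := fun i =>
      ⟨l[(i : ℕ)]'(hlt i), by rw [← hget]; exact (h3 i (hlt i)).1⟩
    have hw : Function.Injective w := by
      have aux : ∀ i k : Fin (B.arity ⟨g, h1⟩), k < i → w i ≠ w k := fun i k hik h => by
        have := (h3 i (hlt i)).2 k hik
        rw [hget _ (hlt i), hget _ (hlt k)] at this
        exact this (congrArg Fin.val h)
      intro i k hik
      rcases lt_trichotomy i k with h | h | h
      · exact absurd hik.symm (aux k i h)
      · exact h
      · exact absurd hik (aux i k h)
    refine ⟨⟨⟨g, h1⟩, ⟨w, hw⟩⟩, Prod.ext rfl ?_⟩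
    refine List.ext_getElem (by simpa using h2') fun i h4 h5 => ?_
    simp [w]
  · rintro ⟨g, rfl⟩
    refine ⟨g.gate.2, by simp [List.getD_eq_getElem?_getD], fun i hi => ?_⟩
    simp only [List.length_ofFn] at hi
    refine ⟨by simp [List.getD_eq_getElem?_getD, hi], fun k hk h => ?_⟩
    have hk' := hk.trans hi
    simp only [List.getD_eq_getElem?_getD, List.length_ofFn, hi, hk', getElem?_pos,
      List.getElem_ofFn, Option.getD_some] at h
    have := g.wires.injective (Fin.ext h)
    simp only [Fin.mk.injEq] at this
    omega

theorem isCircuit_iff {B : GateSet} {S : RawCircuit} :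
    isCircuit B S = true ↔ ∃ C : Circuit B S.1, C.raw = S := by
  obtain ⟨n, l⟩ := S
  have h : isCircuit B (n, l) = true ↔ ∀ s ∈ l, isCircuitStep B n s = true := by
    rw [isCircuit, allBelow_eq_true, List.forall_mem_iff_forall_getElem]
    refine forall₂_congr fun i hi => ?_
    simp only at hi
    simp [List.getD_eq_getElem?_getD, hi]
  rw [h]
  simp only [isCircuitStep_iff]
  constructor
  · intro h
    choose f hf using h
    refine ⟨l.attach.map fun s => f s.1 s.2, Prod.ext rfl ?_⟩
    simp only [Circuit.raw, List.map_map]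
    conv_rhs => rw [← List.attach_map_subtype_val l]
    exact List.map_congr_left fun s _ => (hf s.1 s.2).symm
  · rintro ⟨C, hC⟩ s hs
    have : l = C.map fun g => ((g.gate : ℕ), List.ofFn fun i => (g.wires i : ℕ)) :=
      (congrArg Prod.snd hC).symm
    rw [this] at hs
    obtain ⟨g, _, hg⟩ := List.mem_map.1 hs
    exact ⟨g, hg.symm⟩

/-! ### Expectation values -/

section Expect

variable {n : ℕ}

theorem expect_eq_sum (A : Op n) (v : Qubits n) :
    expect A v = (∑ x, (∑ y, A x y * v y) * star (v x)).re := by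
  rw [expect, PiLp.inner_apply]
  rfl

theorem expect_add (A A' : Op n) (v : Qubits n) : expect (A + A') v = expect A v + expect A' v := by
  simp only [expect, map_add, LinearMap.add_apply, inner_add_right, Complex.add_re]

theorem expect_real_smul (c : ℝ) (A : Op n) (v : Qubits n) :
    expect ((c : ℂ) • A) v = c * expect A v := by
  simp only [expect, map_smul, LinearMap.smul_apply, inner_smul_right, Complex.re_ofReal_mul]

theorem expect_smul (A : Op n) (z : ℂ) (v : Qubits n) : expect A (z • v) = ‖z‖ ^ 2 * expect A v := by
  rw [expect, expect, map_smul, inner_smul_left, inner_smul_right, ← mul_assoc,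
    ← Complex.normSq_eq_conj_mul_self, Complex.normSq_eq_norm_sq, Complex.re_ofReal_mul]

theorem expect_ketbra (w v : Qubits n) : expect (ketbra w) v = ‖(inner ℂ v w : ℂ)‖ ^ 2 := by
  have h : ∀ x, (∑ y, ketbra w x y * v y) * star (v x) = (w x * star (v x)) * inner ℂ w v := by
    intro x
    simp only [ketbra, Matrix.vecMulVec_apply, PiLp.inner_apply, RCLike.inner_apply, Pi.star_apply,
      Finset.mul_sum, Finset.sum_mul]
    refine Finset.sum_congr rfl fun y _ => ?_
    change _ = _ * (_ * star _)
    ring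
  have h2 : ∑ x, w x * star (v x) = inner ℂ v w := by
    rw [PiLp.inner_apply]
    rfl
  rw [expect_eq_sum]
  simp only [h]
  rw [← Finset.sum_mul, h2, ← inner_conj_symm w v, Complex.mul_conj, Complex.ofReal_re,
    Complex.normSq_eq_norm_sq]

/-- Bundled so that, being also continuous, it can be applied term by term to the series for
`semiDensity`. -/
def expectHom (v : Qubits n) : Op n →+ ℝ where
  toFun A := expect A v
  map_zero' := by simp [expect]
  map_add' A A' := expect_add A A' v

theorem continuous_expectHom (v : Qubits n) : Continuous (expectHom v) := by
  change Continuous fun A : Op n => expect A v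
  simp only [expect_eq_sum]
  refine Complex.continuous_re.comp (continuous_finsetSum _ fun x _ => ?_)
  refine (continuous_finsetSum _ fun y _ => ?_).mul continuous_const
  exact (continuous_apply_apply x y).mul continuous_const

theorem continuous_expect (A : Op n) : Continuous fun v : Qubits n => expect A v := by
  unfold expect
  exact Complex.continuous_re.comp
    (continuous_id.inner (LinearMap.continuous_of_finiteDimensional _))

end Expect

/-! ### The universal semi-density matrix -/

section SemiDensity

variable {U : List Bool →. List Bool} {B : GateSet} {n : ℕ}

/-- The programs for circuits on `n` qubits, together with these circuits. -/
abbrev Programs (U : List Bool →. List Bool) (B : GateSet) (n : ℕ) : Type :=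
  {x : List Bool × Circuit B n // Circuit.description x.2 ∈ U x.1}

/-- A program determines its circuit, because descriptions are injective, so this is a Kraft sum
over distinct halting programs. -/
theorem kraft_programs (hU : IsPrefixFreeMachine U) :
    Summable (fun x : Programs U B n => ((2 : ℝ) ^ x.1.1.length)⁻¹) ∧
      ∑' x : Programs U B n, ((2 : ℝ) ^ x.1.1.length)⁻¹ ≤ 1 := by
  classical
  have hinj : Function.Injective fun x : Programs U B n => x.1.1 := by
    rintro ⟨⟨p, C⟩, hx⟩ ⟨⟨q, C'⟩, hy⟩ h
    obtain rfl : p = q := h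
    obtain rfl : C = C' := description_injective (Part.mem_unique hx hy)
    rfl
  have hle : ∀ T : Finset (Programs U B n), ∑ x ∈ T, ((2 : ℝ) ^ x.1.1.length)⁻¹ ≤ 1 := by
    intro T
    have := kraft (S := T.image fun x => x.1.1) (by
      intro p hp q hq hpq
      obtain ⟨x, _, rfl⟩ := Finset.mem_image.1 hp
      obtain ⟨y, _, rfl⟩ := Finset.mem_image.1 hq
      exact hU.2 _ _ (Part.dom_iff_mem.2 ⟨_, x.2⟩) (Part.dom_iff_mem.2 ⟨_, y.2⟩) hpq)
    rwa [Finset.sum_image fun x _ y _ h => hinj h] at this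
  exact ⟨summable_of_sum_le (fun x => by positivity) hle,
    Real.tsum_le_of_sum_le (fun x => by positivity) hle⟩

theorem hasSum_expect_semiDensity (hU : IsPrefixFreeMachine U) (v : Qubits n) :
    HasSum (fun x : Programs U B n =>
      ((2 : ℝ) ^ x.1.1.length)⁻¹ * ‖(inner ℂ v (Circuit.output x.1.2) : ℂ)‖ ^ 2)
      (expect (semiDensity U B n) v) := by
  have h := (semiDensity_summable hU B n).hasSum.map (expectHom v) (continuous_expectHom v)
  refine h.congr_fun fun x => ?_
  change _ = expect (((2 : ℂ) ^ x.1.1.length)⁻¹ • ketbra (Circuit.output x.1.2)) v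
  have hc : ((2 : ℂ) ^ x.1.1.length)⁻¹ = (((2 : ℝ) ^ x.1.1.length)⁻¹ : ℝ) := by push_cast; rfl
  rw [hc, expect_real_smul, expect_ketbra]

theorem expect_semiDensity_nonneg (hU : IsPrefixFreeMachine U) (v : Qubits n) :
    0 ≤ expect (semiDensity U B n) v :=
  (hasSum_expect_semiDensity hU v).nonneg fun x => by positivity

theorem expect_semiDensity_le_one (hU : IsPrefixFreeMachine U) {v : Qubits n} (hv : ‖v‖ = 1) :
    expect (semiDensity U B n) v ≤ 1 := by
  refine le_trans ?_ (kraft_programs (B := B) (n := n) hU).2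
  refine hasSum_le (fun x => ?_) (hasSum_expect_semiDensity hU v) (kraft_programs hU).1.hasSum
  refine mul_le_of_le_one_right (by positivity) ?_
  have := norm_inner_le_norm (𝕜 := ℂ) v (Circuit.output x.1.2)
  rw [hv, norm_output, mul_one] at this
  exact pow_le_one₀ (norm_nonneg _) this

theorem le_expect_of_Hbar_le (hU : IsPrefixFreeMachine U) {v : Qubits n} {r : ℝ}
    (h : Hbar U B v ≤ (r : EReal)) : (2 : ℝ) ^ (-r) ≤ expect (semiDensity U B n) v := by
  unfold Hbar at h
  split_ifs at h with h0
  · exact absurd h (by simp)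
  · have hpos := lt_of_le_of_ne (expect_semiDensity_nonneg (B := B) hU v) (Ne.symm h0)
    have h1 : -Real.logb 2 (expect (semiDensity U B n) v) ≤ r := by exact_mod_cast h
    rw [← Real.le_logb_iff_rpow_le (by norm_num) hpos]
    linarith

end SemiDensity

/-! ### Trace distance of pure states -/

-- The difference A of the two projectors has rank at most 2, so Cauchy–Schwarz over its nonzero
-- singular values gives ‖A‖₁² ≤ 2 Tr(A†A), and Tr(A†A) = 2(1 - |⟨v,w⟩|²). Equality holds in fact,
-- but only this direction is needed.
open scoped ComplexOrder in
theorem traceDist_le {n : ℕ} {v w : Qubits n} (hv : ‖v‖ = 1) (hw : ‖w‖ = 1) :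
    traceDist v w ≤ √(1 - ‖(inner ℂ v w : ℂ)‖ ^ 2) := by
  classical
  set A : Op n := ketbra v - ketbra w with hA
  have hH := Matrix.isHermitian_conjTranspose_mul_self A
  have hpos : ∀ i, 0 ≤ hH.eigenvalues i :=
    (Matrix.posSemidef_conjTranspose_mul_self A).eigenvalues_nonneg
  have htr : ∑ i, hH.eigenvalues i = 2 * (1 - ‖(inner ℂ v w : ℂ)‖ ^ 2) := by
    have h1 := hH.trace_eq_sum_eigenvalues
    have hs : ∀ u : Qubits n, (ketbra u)ᴴ = ketbra u := fun u => by
      rw [ketbra, Matrix.conjTranspose_vecMulVec, star_star]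
    have hm : ∀ u u' : Qubits n, (ketbra u * ketbra u').trace =
        ((‖(inner ℂ u u' : ℂ)‖ ^ 2 : ℝ) : ℂ) := fun u u' => by
      have e1 : star u.ofLp ⬝ᵥ u'.ofLp = inner ℂ u u' := by
        rw [PiLp.inner_apply, dotProduct]
        exact Finset.sum_congr rfl fun x _ => mul_comm _ _
      have e2 : u.ofLp ⬝ᵥ star u'.ofLp = inner ℂ u' u := by
        rw [PiLp.inner_apply, dotProduct]
        exact Finset.sum_congr rfl fun x _ => rfl
      rw [ketbra, ketbra, Matrix.vecMulVec_mul_vecMulVec, Matrix.trace_vecMulVec, dotProduct_smul,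
        e1, e2, ← inner_conj_symm u' u, smul_eq_mul, Complex.mul_conj, Complex.normSq_eq_norm_sq]
    have h2 : (Aᴴ * A).trace = ((2 * (1 - ‖(inner ℂ v w : ℂ)‖ ^ 2) : ℝ) : ℂ) := by
      rw [hA, Matrix.conjTranspose_sub, hs, hs, sub_mul, mul_sub, mul_sub, Matrix.trace_sub,
        Matrix.trace_sub, Matrix.trace_sub, hm, hm, hm, hm, norm_inner_symm w v]
      have h3 : ∀ u : Qubits n, ‖u‖ = 1 → ‖(inner ℂ u u : ℂ)‖ = 1 := fun u hu => by
        rw [inner_self_eq_norm_sq_to_K, hu]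
        simp
      rw [h3 v hv, h3 w hw]
      push_cast
      ring
    rw [h2] at h1
    refine Complex.ofReal_injective ?_
    rw [Complex.ofReal_sum]
    exact h1.symm
  have hcard : (Finset.univ.filter fun i => hH.eigenvalues i ≠ 0).card ≤ 2 := by
    have h1 := hH.rank_eq_card_non_zero_eigs
    rw [Matrix.rank_conjTranspose_mul_self, Fintype.card_subtype] at h1
    have h2 : A = (Matrix.of ![v.ofLp, w.ofLp])ᵀ *
        Matrix.of ![star v.ofLp, -star w.ofLp] := by
      ext x y
      simp [hA, ketbra, Matrix.mul_apply, Matrix.vecMulVec_apply, Fin.sum_univ_two, sub_eq_add_neg]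
    rw [← h1, h2]
    exact (Matrix.rank_mul_le_left _ _).trans (Matrix.rank_le_card_width _)
  have hsum : schattenOne A = ∑ i with hH.eigenvalues i ≠ 0, √(hH.eigenvalues i) := by
    rw [schattenOne, Finset.sum_filter]
    refine Finset.sum_congr rfl fun i _ => ?_
    split_ifs with h
    · rfl
    · rw [not_not.1 h, Real.sqrt_zero]
  have hsq : schattenOne A ^ 2 ≤ 2 * (2 * (1 - ‖(inner ℂ v w : ℂ)‖ ^ 2)) := by
    rw [hsum, ← htr]
    refine (sq_sum_le_card_mul_sum_sq).trans ?_
    refine mul_le_mul (by exact_mod_cast hcard) ?_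
      (Finset.sum_nonneg fun i _ => sq_nonneg _) (by norm_num)
    calc ∑ i with hH.eigenvalues i ≠ 0, √(hH.eigenvalues i) ^ 2
        = ∑ i with hH.eigenvalues i ≠ 0, hH.eigenvalues i :=
          Finset.sum_congr rfl fun i _ => Real.sq_sqrt (hpos i)
      _ ≤ _ := Finset.sum_le_sum_of_subset_of_nonneg (Finset.filter_subset _ _)
          fun i _ _ => hpos i
  refine Real.le_sqrt_of_sq_le ?_
  rw [traceDist, div_pow]
  linarith

/-! ### Robust span -/

theorem ketbra_isHermitian {n : ℕ} (v : Qubits n) : (ketbra v).IsHermitian := by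
  rw [Matrix.IsHermitian, ketbra, Matrix.conjTranspose_vecMulVec, star_star]

/-- On the orthogonal complement of the robust span, the family has total weight at most `γ`. -/
theorem sum_expect_le_of_mem_orthogonal {n : ℕ} {ι : Type*} [Fintype ι] {ρ : ι → Op n}
    (hρ : ∀ i, (ρ i).IsHermitian) {γ : ℝ} (hγ : 0 ≤ γ) {φ : Qubits n}
    (hφ : φ ∈ (robustSpan ρ γ)ᗮ) : ∑ i, expect (ρ i) φ ≤ γ * ‖φ‖ ^ 2 := by
  classical
  rcases isEmpty_or_nonempty ι with hι | hι
  · simpa using by positivity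
  set L : ℝ := (Fintype.card ι : ℝ) with hL
  have hLpos : 0 < L := by
    rw [hL]
    exact_mod_cast Fintype.card_pos
  set A : Op n := (Fintype.card ι : ℂ)⁻¹ • ∑ i, ρ i with hA
  have hAH : A.IsHermitian := by
    rw [Matrix.IsHermitian, hA, Matrix.conjTranspose_smul, Matrix.conjTranspose_sum]
    congr 1
    · simp
    · exact Finset.sum_congr rfl fun i _ => hρ i
  have hexp : expect A φ = L⁻¹ * ∑ i, expect (ρ i) φ := by
    have h1 : (Fintype.card ι : ℂ)⁻¹ = ((L⁻¹ : ℝ) : ℂ) := by simp [hL]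
    rw [hA, h1, expect_real_smul]
    congr 1
    exact map_sum (expectHom φ) ρ Finset.univ
  have hsym : (Matrix.toEuclideanLin A).IsSymmetric := Matrix.isSymmetric_toEuclideanLin_iff.2 hAH
  set b := hsym.eigenvectorBasis (n := Module.finrank ℂ (Qubits n)) rfl with hb
  have hle : expect A φ ≤ γ / L * ‖φ‖ ^ 2 := by
    rw [expect, ← b.sum_inner_mul_inner φ, Complex.re_sum, ← b.sum_sq_norm_inner_right φ,
      Finset.mul_sum]
    refine Finset.sum_le_sum fun j _ => ?_
    set t := hsym.eigenvalues rfl j with ht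
    have hTb : Matrix.toEuclideanLin A (b j) = (t : ℂ) • b j := hsym.apply_eigenvectorBasis rfl j
    rw [← hsym, hTb, inner_smul_left, Complex.conj_ofReal, mul_left_comm, ← inner_conj_symm φ (b j),
      ← Complex.normSq_eq_conj_mul_self, Complex.normSq_eq_norm_sq, ← Complex.ofReal_mul,
      Complex.ofReal_re]
    -- Eigenvectors with eigenvalue at least γ/L lie in the robust span, so `φ` has no component
    -- along them.
    rcases le_or_gt (γ / L) t with h | h
    · have hmem : b j ∈ robustSpan ρ γ := Submodule.subset_span ⟨hι, t, h, hTb⟩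
      rw [Submodule.inner_right_of_mem_orthogonal hmem hφ]
      simp
    · exact mul_le_mul_of_nonneg_right h.le (by positivity)
  rw [hexp, inv_mul_eq_div, div_mul_eq_mul_div] at hle
  exact (div_le_div_iff_of_pos_right hLpos).1 hle

theorem overlap_eq {n : ℕ} (v : Qubits n) (K : Submodule ℂ (Qubits n)) :
    overlap v K = ‖v‖ ^ 2 - ‖v - K.starProjection v‖ ^ 2 := by
  have h1 : ‖v‖ ^ 2 = ‖K.starProjection v‖ ^ 2 + ‖v - K.starProjection v‖ ^ 2 := by
    have := K.norm_sq_eq_add_norm_sq_starProjection v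
    rwa [Submodule.starProjection_orthogonal_val] at this
  have h2 : overlap v K = ‖K.starProjection v‖ ^ 2 := by
    have : inner ℂ v (K.starProjection v) =
        (inner ℂ (K.starProjection v) (K.starProjection v) : ℂ) := by
      rw [K.inner_starProjection_left_eq_right,
        Submodule.starProjection_eq_self_iff.2 (K.starProjection_apply_mem v)]
    rw [overlap, this, inner_self_eq_norm_sq_to_K]
    norm_cast
  linarith

/-- A family of easy states whose span contains, up to a small error, every vector of low
complexity has a robust span with the same property. -/
theorem le_overlap_easyRobustSpan {U : List Bool →. List Bool} (hU : IsPrefixFreeMachine U)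
    {B : GateSet} {n : ℕ} {s r ε γ t : ℝ} (hε0 : 0 ≤ ε) (hε1 : ε ≤ 1) (hγ : 0 ≤ γ) (ht : 0 < t)
    {ψ : Qubits n} (hψ : ‖ψ‖ = 1) (hr : HbarSmooth U B (1 - ε) ψ ≤ (r : EReal))
    {ι : Type*} [Fintype ι] (f : ι → Qubits n) (hf : ∀ i, ketbra (f i) ∈ easyStates U B n s)
    (hinj : Function.Injective fun i => ketbra (f i))
    (hframe : ∀ φ ∈ Submodule.span ℂ (Set.range f),
      t * ‖φ‖ ^ 2 ≤ ∑ i, ‖(inner ℂ φ (f i) : ℂ)‖ ^ 2)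
    (hperp : ∀ φ ∈ (Submodule.span ℂ (Set.range f))ᗮ, ‖φ‖ = 1 →
      expect (semiDensity U B n) φ < 2 ^ (-r)) :
    1 - √(2 * ε) - γ * (4 / t) ≤ overlap ψ (easyRobustSpan U B n s γ) := by
  set K := easyRobustSpan U B n s γ with hK
  set T := Submodule.span ℂ (Set.range f) with hT
  set u := ψ - K.starProjection ψ with hu
  set v := ψ - T.starProjection ψ with hv
  have huK : u ∈ Kᗮ := K.sub_starProjection_mem_orthogonal ψ
  have hvT : v ∈ Tᗮ := T.sub_starProjection_mem_orthogonal ψ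
  have hov : overlap ψ K = 1 - ‖u‖ ^ 2 := by rw [overlap_eq, hψ, one_pow]
  have hu1 : ‖u‖ ≤ 1 := by
    have := Kᗮ.norm_starProjection_apply_le ψ
    rwa [Submodule.starProjection_orthogonal_val, hψ] at this
  have hTψ : ‖T.starProjection ψ‖ ≤ 1 := by
    have := T.norm_starProjection_apply_le ψ
    rwa [hψ] at this
  have hx0 := Real.sqrt_nonneg (2 * ε)
  have hx2 : √(2 * ε) ^ 2 = 2 * ε := Real.sq_sqrt (by linarith)
  have hgt : 0 ≤ γ * (4 / t) := by positivity
  rw [hov]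
  -- In the first case the claimed lower bound is at most 0.
  rcases le_or_gt 1 √(2 * ε) with hx1 | hx1
  · nlinarith [norm_nonneg u]
  -- the component of `ψ` outside of `T` is small
  have hv2 : ‖v‖ ^ 2 ≤ 2 * ε - ε ^ 2 := by
    by_contra hcon
    push Not at hcon
    have hv0 : 0 < ‖v‖ := by
      refine lt_of_le_of_ne (norm_nonneg _) fun h => ?_
      rw [← h] at hcon
      nlinarith
    have hinner : inner ℂ ψ v = ((‖v‖ ^ 2 : ℝ) : ℂ) := by
      have h1 : ψ = T.starProjection ψ + v := by simp [hv]
      conv_lhs => rw [h1]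
      rw [inner_add_left, Submodule.inner_right_of_mem_orthogonal
        (T.starProjection_apply_mem ψ) hvT, zero_add, inner_self_eq_norm_sq_to_K]
      norm_cast
    -- The overlap of `w` with `ψ` is ‖v‖, so their trace distance is at most √(1 - ‖v‖²). The
    -- threshold 2ε - ε² is chosen since 1 - (2ε - ε²) = (1 - ε)².
    set w : Qubits n := ((‖v‖⁻¹ : ℝ) : ℂ) • v with hw
    have hw1 : ‖w‖ = 1 := by
      rw [hw, norm_smul, Complex.norm_real, norm_inv, norm_norm, inv_mul_cancel₀ hv0.ne']
    have hwi : ‖(inner ℂ ψ w : ℂ)‖ = ‖v‖ := by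
      rw [hw, inner_smul_right, hinner, ← Complex.ofReal_mul, Complex.norm_real, sq,
        inv_mul_cancel_left₀ hv0.ne', norm_norm]
    have hwd : traceDist ψ w ≤ 1 - ε := by
      refine (traceDist_le hψ hw1).trans ?_
      rw [hwi]
      refine Real.sqrt_le_iff.2 ⟨by linarith, by nlinarith⟩
    have h1 : Hbar U B w ≤ (r : EReal) :=
      (le_iSup₂ (f := fun (w : Qubits n) (_ : ‖w‖ = 1 ∧ traceDist ψ w ≤ 1 - ε) => Hbar U B w)
        w ⟨hw1, hwd⟩).trans hr
    exact absurd (le_expect_of_Hbar_le hU h1)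
      (not_le.2 (hperp w (Tᗮ.smul_mem _ hvT) hw1))
  -- the component of `u` in `T` is small
  have hTu : ‖T.starProjection u‖ ≤ √(γ / t) * ‖u‖ := by
    have h1 := hframe (T.starProjection u) (T.starProjection_apply_mem u)
    have h2 : ∀ i, inner ℂ (T.starProjection u) (f i) = (inner ℂ u (f i) : ℂ) := fun i => by
      rw [T.inner_starProjection_left_eq_right, Submodule.starProjection_eq_self_iff.2
        (Submodule.subset_span (Set.mem_range_self i))]
    simp only [h2] at h1
    -- The `f i` represent distinct members of the family of all easy states, so their weight on `u`
    -- is at most the total weight. Injectivity of `fun i => ketbra (f i)` prevents double counting.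
    have h3 : ∑ i, ‖(inner ℂ u (f i) : ℂ)‖ ^ 2 ≤ γ * ‖u‖ ^ 2 := by
      refine le_trans ?_ (sum_expect_le_of_mem_orthogonal (fun ρ => ?_) hγ huK)
      · have h4 : ∀ i, ketbra (f i) ∈ (easyStates_finite U B n s).toFinset := fun i =>
          (Set.Finite.mem_toFinset _).2 (hf i)
        have h5 : Function.Injective fun i =>
            (⟨ketbra (f i), h4 i⟩ : (easyStates_finite U B n s).toFinset) := fun i j hij =>
          hinj (congrArg Subtype.val hij)
        calc ∑ i, ‖(inner ℂ u (f i) : ℂ)‖ ^ 2 = ∑ i, expect (ketbra (f i)) u := by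
              simp only [expect_ketbra]
          _ = ∑ ρ ∈ Finset.univ.map ⟨_, h5⟩, expect (ρ : Op n) u := by
              rw [Finset.sum_map]
              rfl
          _ ≤ ∑ ρ : (easyStates_finite U B n s).toFinset, expect (ρ : Op n) u := by
              refine Finset.sum_le_sum_of_subset_of_nonneg (Finset.subset_univ _) fun ρ _ _ => ?_
              obtain ⟨w, _, _, hw⟩ := (Set.Finite.mem_toFinset _).1 ρ.2
              rw [hw, expect_ketbra]
              positivity
      · obtain ⟨w, _, _, hw⟩ := (Set.Finite.mem_toFinset _).1 ρ.2
        rw [hw]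
        exact ketbra_isHermitian w
    refine abs_le_of_sq_le_sq' ?_ (by positivity) |>.2
    rw [mul_pow, Real.sq_sqrt (by positivity), div_mul_eq_mul_div, le_div_iff₀ ht]
    linarith
  -- Here ‖u‖² = ⟨ψ,u⟩ = ⟨P_T ψ, P_T u⟩ + ⟨v,u⟩, and each term is bounded by Cauchy–Schwarz.
  have huu : ‖u‖ ^ 2 ≤ (√(γ / t) + ‖v‖) * ‖u‖ := by
    have h1 : ((‖u‖ ^ 2 : ℝ) : ℂ) = inner ℂ ψ u := by
      have h2 : ψ = K.starProjection ψ + u := by simp [hu]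
      conv_rhs => rw [h2]
      rw [inner_add_left, Submodule.inner_right_of_mem_orthogonal
        (K.starProjection_apply_mem ψ) huK, zero_add, inner_self_eq_norm_sq_to_K]
      norm_cast
    have h2 : inner ℂ ψ u = (inner ℂ (T.starProjection ψ) (T.starProjection u) + inner ℂ v u : ℂ) := by
      have h3 : ψ = T.starProjection ψ + v := by simp [hv]
      conv_lhs => rw [h3]
      rw [inner_add_left, ← T.inner_starProjection_left_eq_right,
        Submodule.starProjection_eq_self_iff.2 (T.starProjection_apply_mem ψ)]
    have h3 := congrArg norm (h1.trans h2)
    rw [Complex.norm_real, Real.norm_eq_abs, abs_of_nonneg (by positivity)] at h3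
    rw [h3]
    refine (norm_add_le _ _).trans ?_
    have h4 := norm_inner_le_norm (𝕜 := ℂ) (T.starProjection ψ) (T.starProjection u)
    have h5 := norm_inner_le_norm (𝕜 := ℂ) v u
    nlinarith [norm_nonneg (T.starProjection u), norm_nonneg u]
  have hule : ‖u‖ ≤ √(γ / t) + ‖v‖ := by
    rcases (norm_nonneg u).eq_or_lt with h | h
    · rw [← h]
      positivity
    · exact le_of_mul_le_mul_right (by linarith) h
  have hg2 : √(γ / t) ^ 2 = γ / t := Real.sq_sqrt (by positivity)
  -- The weighted inequality (a + b)² ≤ 4a² + (4/3)b². The factor 4/3 is small enough for the next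
  -- estimate to hold up to √(2ε) = 1.
  have h6 : ‖u‖ ^ 2 ≤ 4 * √(γ / t) ^ 2 + 4 / 3 * ‖v‖ ^ 2 := by
    nlinarith [norm_nonneg u, norm_nonneg v, Real.sqrt_nonneg (γ / t),
      sq_nonneg (√(γ / t) - ‖v‖ / 3)]
  -- With x = √(2ε) < 1, right side minus left side is x(1 - x)(3 - x - x²)/3.
  have h7 : 4 / 3 * (2 * ε - ε ^ 2) ≤ √(2 * ε) := by
    generalize √(2 * ε) = x at *
    have : ε = x ^ 2 / 2 := by linarith
    subst this
    have : 0 ≤ x * ((1 - x) * (3 - x - x ^ 2)) :=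
      mul_nonneg hx0 (mul_nonneg (by linarith) (by nlinarith))
    nlinarith
  have h8 : γ * (4 / t) = 4 * (γ / t) := by ring
  linarith

/-! ### Programs and easy states -/

theorem ketbra_output_mem_easyStates {U : List Bool →. List Bool} {B : GateSet} {n : ℕ}
    {C : Circuit B n} {q : List Bool} (hq : Circuit.description C ∈ U q) {s : ℝ}
    (hs : (q.length : ℝ) ≤ s) : ketbra (Circuit.output C) ∈ easyStates U B n s := by
  refine ⟨Circuit.output C, norm_output C, ?_, rfl⟩
  have h1 : Knet U B 0 (Circuit.output C) ≤ (q.length : ℕ∞) := by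
    refine sInf_le ⟨q, C, hq, ?_, rfl⟩
    rw [inner_self_eq_norm_sq_to_K, norm_output]
    simp
  have h2 : ((Knet U B 0 (Circuit.output C) : ENNReal) : EReal) ≤
      (((q.length : ℕ∞) : ENNReal) : EReal) := by
    exact_mod_cast h1
  refine h2.trans ?_
  have h3 : ((((q.length : ℕ∞) : ENNReal)) : EReal) = ((q.length : ℝ) : EReal) := by
    rw [ENat.toENNReal_coe, ← ENNReal.ofReal_natCast, EReal.coe_ennreal_ofReal,
      max_eq_left (Nat.cast_nonneg _)]
  rw [h3]
  exact_mod_cast hs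

/-- The machine that halts only on the empty program, with output `x`, is prefix-free, and `U`
simulates it. -/
theorem IsUniversalMachine.exists_program {U : List Bool →. List Bool}
    (hU : IsUniversalMachine U) (x : List Bool) : ∃ q, x ∈ U q := by
  let V : List Bool →. List Bool := fun p => ((cond (p == []) (some x) none : Option _) : Part _)
  have hdom : ∀ p, (V p).Dom → p = [] := by
    intro p hp
    cases p with
    | nil => rfl
    | cons a p => simp [V] at hp
  have hV : IsPrefixFreeMachine V := by
    refine ⟨Computable.ofOption (by fun_prop), fun p q hp hq _ => ?_⟩
    rw [hdom p hp, hdom q hq]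
  obtain ⟨c, hc⟩ := hU.2 V hV
  obtain ⟨q, hq, -⟩ := hc [] x (by simp [V])
  exact ⟨q, hq⟩

/-! ### Nearly orthonormal families -/

section NearlyOrthonormal

variable {E : Type*} [NormedAddCommGroup E] [InnerProductSpace ℂ E] {m : ℕ} {f : Fin m → E}

/-- Each unordered pair counts twice, and the thresholds sum to less than 1/12. Thus the Gram matrix
differs from its diagonal by Hilbert–Schmidt norm at most 1/2. -/
theorem sum_norm_inner_sq_le
    (hf : ∀ j, ∑ i with i < j, ‖(inner ℂ (f i) (f j) : ℂ)‖ ^ 2 ≤ (1 / 4) ^ ((j : ℕ) + 2)) :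
    ∑ i, ∑ j with j ≠ i, ‖(inner ℂ (f i) (f j) : ℂ)‖ ^ 2 ≤ 1 / 4 := by
  have hgeom : ∀ k : ℕ, ∑ j ∈ Finset.range k, (1 / 4 : ℝ) ^ (j + 2) =
      1 / 12 * (1 - (1 / 4) ^ k) := fun k => by
    induction k with
    | zero => simp
    | succ k ih =>
      rw [Finset.sum_range_succ, ih]
      ring
  have h1 : ∑ j, ∑ i with i < j, ‖(inner ℂ (f i) (f j) : ℂ)‖ ^ 2 ≤ 1 / 12 := by
    refine (Finset.sum_le_sum fun j _ => hf j).trans ?_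
    rw [Fin.sum_univ_eq_sum_range fun j => (1 / 4 : ℝ) ^ (j + 2), hgeom]
    have : (0 : ℝ) ≤ (1 / 4) ^ m := by positivity
    linarith
  have h2 : ∑ i, ∑ j with j ≠ i, ‖(inner ℂ (f i) (f j) : ℂ)‖ ^ 2 =
      ∑ j, ∑ i with i < j, ‖(inner ℂ (f i) (f j) : ℂ)‖ ^ 2 +
        ∑ j, ∑ i with i < j, ‖(inner ℂ (f i) (f j) : ℂ)‖ ^ 2 := by
    have h3 : ∀ i, ∑ j with j ≠ i, ‖(inner ℂ (f i) (f j) : ℂ)‖ ^ 2 =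
        ∑ j with j < i, ‖(inner ℂ (f j) (f i) : ℂ)‖ ^ 2 +
          ∑ j, if i < j then ‖(inner ℂ (f i) (f j) : ℂ)‖ ^ 2 else 0 := fun i => by
      rw [Finset.sum_filter, Finset.sum_filter, ← Finset.sum_add_distrib]
      refine Finset.sum_congr rfl fun j _ => ?_
      rcases lt_trichotomy i j with h | h | h
      · simp [h, h.ne', h.not_gt]
      · simp [h]
      · simp [h, h.ne, h.not_gt, norm_inner_symm (f i) (f j)]
    simp only [h3]
    rw [Finset.sum_add_distrib, Finset.sum_comm (f := fun i j =>
      if i < j then ‖(inner ℂ (f i) (f j) : ℂ)‖ ^ 2 else 0)]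
    simp only [Finset.sum_filter]
  rw [h2]
  linarith

/-- The left side is the quadratic form of the off-diagonal part of the Gram matrix. Cauchy–Schwarz
over pairs bounds it by the Hilbert–Schmidt norm, at most 1/2, times Σ|c_i|². -/
theorem abs_norm_sq_sum_sub_le (h1 : ∀ i, ‖f i‖ = 1)
    (hf : ∀ j, ∑ i with i < j, ‖(inner ℂ (f i) (f j) : ℂ)‖ ^ 2 ≤ (1 / 4) ^ ((j : ℕ) + 2))
    (c : Fin m → ℂ) : |‖∑ i, c i • f i‖ ^ 2 - ∑ i, ‖c i‖ ^ 2| ≤ 1 / 2 * ∑ i, ‖c i‖ ^ 2 := by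
  have hexp : ((‖∑ i, c i • f i‖ ^ 2 - ∑ i, ‖c i‖ ^ 2 : ℝ) : ℂ) =
      ∑ i, ∑ j with j ≠ i, (starRingEnd ℂ (c i) * c j) * inner ℂ (f i) (f j) := by
    have h2 : ((‖∑ i, c i • f i‖ ^ 2 : ℝ) : ℂ) = inner ℂ (∑ i, c i • f i) (∑ i, c i • f i) := by
      rw [inner_self_eq_norm_sq_to_K]
      norm_cast
    rw [Complex.ofReal_sub, h2, sum_inner, Complex.ofReal_sum, ← Finset.sum_sub_distrib]
    refine Finset.sum_congr rfl fun i _ => ?_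
    rw [inner_sum, ← Finset.add_sum_erase _ _ (Finset.mem_univ i), inner_smul_left,
      inner_smul_right, inner_self_eq_norm_sq_to_K, h1]
    have h3 : starRingEnd ℂ (c i) * (c i * ((1 : ℝ) : ℂ) ^ 2) = ((‖c i‖ ^ 2 : ℝ) : ℂ) := by
      rw [Complex.ofReal_one, one_pow, mul_one, ← Complex.normSq_eq_conj_mul_self,
        Complex.normSq_eq_norm_sq]
    refine (congrArg₂ (· - ·) (congrArg₂ (· + ·) h3 rfl) rfl).trans ?_
    rw [add_sub_cancel_left, Finset.filter_ne']
    refine Finset.sum_congr rfl fun j _ => ?_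
    rw [inner_smul_left, inner_smul_right, mul_assoc]
  rw [← Real.norm_eq_abs, ← Complex.norm_real, hexp]
  have hsig : ∀ F : Fin m → Fin m → ℂ, ‖∑ i, ∑ j with j ≠ i, F i j‖ ≤
      ∑ p ∈ Finset.univ.sigma fun i => Finset.univ.filter fun j => j ≠ i, ‖F p.1 p.2‖ := by
    intro F
    rw [Finset.sum_sigma']
    exact norm_sum_le _ _
  refine (hsig _).trans ?_
  simp only [norm_mul, RCLike.norm_conj]
  refine abs_le_of_sq_le_sq' ?_ (by positivity) |>.2
  refine (Finset.sum_mul_sq_le_sq_mul_sq _ _ _).trans ?_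
  have h4 : ∑ p ∈ Finset.univ.sigma fun i : Fin m => Finset.univ.filter fun j => j ≠ i,
      (‖c p.1‖ * ‖c p.2‖) ^ 2 ≤ (∑ i, ‖c i‖ ^ 2) ^ 2 := by
    rw [sq (∑ i, ‖c i‖ ^ 2), Finset.sum_mul_sum,
      Finset.sum_sigma (f := fun p : Σ _ : Fin m, Fin m => (‖c p.1‖ * ‖c p.2‖) ^ 2)]
    refine Finset.sum_le_sum fun i _ => ?_
    simp only [mul_pow]
    exact Finset.sum_le_sum_of_subset_of_nonneg (Finset.filter_subset _ _)
      fun _ _ _ => by positivity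
  have h5 : ∑ p ∈ Finset.univ.sigma fun i : Fin m => Finset.univ.filter fun j => j ≠ i,
      ‖(inner ℂ (f p.1) (f p.2) : ℂ)‖ ^ 2 ≤ 1 / 4 := by
    rw [Finset.sum_sigma (f := fun p : Σ _ : Fin m, Fin m => ‖(inner ℂ (f p.1) (f p.2) : ℂ)‖ ^ 2)]
    exact sum_norm_inner_sq_le hf
  refine (mul_le_mul h4 h5 (Finset.sum_nonneg fun _ _ => by positivity) (by positivity)).trans ?_
  rw [mul_pow]
  linarith

/-- Bessel's inequality with a constant. For w = Σ⟨f_i,φ⟩f_i the left side a equals ⟨w,φ⟩, while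
‖w‖² ≤ (3/2)a; apply Cauchy–Schwarz and cancel a. -/
theorem sum_norm_inner_sq_le_of_nearly_orthonormal (h1 : ∀ i, ‖f i‖ = 1)
    (hf : ∀ j, ∑ i with i < j, ‖(inner ℂ (f i) (f j) : ℂ)‖ ^ 2 ≤ (1 / 4) ^ ((j : ℕ) + 2))
    (φ : E) : ∑ i, ‖(inner ℂ (f i) φ : ℂ)‖ ^ 2 ≤ 3 / 2 * ‖φ‖ ^ 2 := by
  set w := ∑ i, (inner ℂ (f i) φ : ℂ) • f i with hw
  have h2 := (abs_le.1 (abs_norm_sq_sum_sub_le h1 hf fun i => inner ℂ (f i) φ)).2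
  rw [← hw] at h2
  set a := ∑ i, ‖(inner ℂ (f i) φ : ℂ)‖ ^ 2 with ha
  have h3 : (a : ℂ) = inner ℂ w φ := by
    rw [hw, sum_inner, ha, Complex.ofReal_sum]
    refine Finset.sum_congr rfl fun i _ => ?_
    rw [inner_smul_left, ← Complex.normSq_eq_conj_mul_self, Complex.normSq_eq_norm_sq]
  have ha0 : 0 ≤ a := Finset.sum_nonneg fun _ _ => by positivity
  have h4 : a ≤ ‖w‖ * ‖φ‖ := by
    have := norm_inner_le_norm (𝕜 := ℂ) w φ
    rwa [← h3, Complex.norm_real, Real.norm_eq_abs, abs_of_nonneg ha0] at this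
  have h5 : a * a ≤ a * (3 / 2 * ‖φ‖ ^ 2) := by
    nlinarith [mul_le_mul h4 h4 ha0 (by positivity), sq_nonneg ‖φ‖]
  rcases ha0.eq_or_lt with h | h
  · rw [← h]
    positivity
  · exact le_of_mul_le_mul_left h5 h

/-- For φ = Σ d_i f_i, Cauchy–Schwarz on ‖φ‖² = Σ d_i⟨φ,f_i⟩ together with Σ|d_i|² ≤ 2‖φ‖² gives the
bound after cancelling ‖φ‖². -/
theorem le_sum_norm_inner_sq_of_nearly_orthonormal (h1 : ∀ i, ‖f i‖ = 1)
    (hf : ∀ j, ∑ i with i < j, ‖(inner ℂ (f i) (f j) : ℂ)‖ ^ 2 ≤ (1 / 4) ^ ((j : ℕ) + 2))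
    {φ : E} (hφ : φ ∈ Submodule.span ℂ (Set.range f)) :
    1 / 2 * ‖φ‖ ^ 2 ≤ ∑ i, ‖(inner ℂ φ (f i) : ℂ)‖ ^ 2 := by
  obtain ⟨d, rfl⟩ := (Submodule.mem_span_range_iff_exists_fun ℂ).1 hφ
  have h2 := (abs_le.1 (abs_norm_sq_sum_sub_le h1 hf d)).1
  set φ := ∑ i, d i • f i with hd
  have h3 : ((‖φ‖ ^ 2 : ℝ) : ℂ) = ∑ i, d i * inner ℂ φ (f i) := by
    have : ((‖φ‖ ^ 2 : ℝ) : ℂ) = inner ℂ φ φ := by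
      rw [inner_self_eq_norm_sq_to_K]
      norm_cast
    rw [this]
    conv_lhs => rw [hd, inner_sum]
    exact Finset.sum_congr rfl fun i _ => inner_smul_right _ _ _
  have h4 : ‖φ‖ ^ 2 ≤ ∑ i, ‖d i‖ * ‖(inner ℂ φ (f i) : ℂ)‖ := by
    have h5 := congrArg norm h3
    rw [Complex.norm_real, Real.norm_eq_abs, abs_of_nonneg (by positivity)] at h5
    rw [h5]
    refine (norm_sum_le _ _).trans (le_of_eq ?_)
    simp only [norm_mul]
  have h6 := Finset.sum_mul_sq_le_sq_mul_sq Finset.univ (fun i => ‖d i‖)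
    fun i => ‖(inner ℂ φ (f i) : ℂ)‖
  set a := ∑ i, ‖(inner ℂ φ (f i) : ℂ)‖ ^ 2
  set b := ∑ i, ‖d i‖ ^ 2
  have ha0 : 0 ≤ a := Finset.sum_nonneg fun _ _ => by positivity
  have h7 : ‖φ‖ ^ 2 * ‖φ‖ ^ 2 ≤ b * a := by
    refine le_trans ?_ h6
    rw [sq (∑ i, _)]
    exact mul_le_mul h4 h4 (by positivity) (Finset.sum_nonneg fun _ _ => by positivity)
  have h8 : ‖φ‖ ^ 2 * ‖φ‖ ^ 2 ≤ ‖φ‖ ^ 2 * (2 * a) := by nlinarith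
  rcases (sq_nonneg ‖φ‖).eq_or_lt with h | h
  · rw [← h]
    simpa using ha0
  · linarith [le_of_mul_le_mul_left h8 h]

end NearlyOrthonormal

/-! ### Universal gate sets -/

theorem exists_unitary_mulVec_eq {n : ℕ} {φ : Qubits n} (hφ : ‖φ‖ = 1) :
    ∃ V ∈ Matrix.unitaryGroup (Fin n → Bool) ℂ, ∀ x, V x (fun _ => false) = φ x := by
  classical
  have horth : Orthonormal ℂ (({(fun _ => false)} : Set (Fin n → Bool)).domRestrict
      fun _ => φ) := by
    constructor
    · intro i
      exact hφ
    · intro i j hij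
      exact absurd (Subsingleton.elim i j) hij
  obtain ⟨b, hb⟩ := horth.exists_orthonormalBasis_extension_of_card_eq
    (by rw [finrank_euclideanSpace])
  refine ⟨Matrix.of fun x y => b y x, ?_, fun x => ?_⟩
  · rw [Matrix.mem_unitaryGroup_iff']
    ext y z
    have h := orthonormal_iff_ite.1 b.orthonormal y z
    rw [Matrix.mul_apply, Matrix.one_apply, ← h, PiLp.inner_apply]
    exact Finset.sum_congr rfl fun x _ => mul_comm _ _
  · rw [Matrix.of_apply, hb _ (Set.mem_singleton _)]

theorem GateSet.IsUniversal.exists_norm_output_sub_lt {B : GateSet} (hB : B.IsUniversal) :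
    ∃ n₀ : ℕ, ∀ n, n₀ ≤ n → ∀ φ : Qubits n, ‖φ‖ = 1 → ∀ η : ℝ, 0 < η →
      ∃ (C : Circuit B n) (z : ℂ), ‖z‖ = 1 ∧ ‖Circuit.output C - z • φ‖ < η := by
  obtain ⟨n₀, h⟩ := hB
  refine ⟨n₀, fun n hn φ hφ η hη => ?_⟩
  obtain ⟨V, hV, hVφ⟩ := exists_unitary_mulVec_eq hφ
  have hcard : (0 : ℝ) < Fintype.card (Fin n → Bool) := by exact_mod_cast Fintype.card_pos
  set N : ℝ := (Fintype.card (Fin n → Bool) : ℝ) with hN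
  -- An error η/(N + 1) in each of the N coordinates gives squared norm at most Nη²/(N + 1)² < η².
  obtain ⟨C, z, hz, hC⟩ := h n hn V hV (η / (N + 1)) (by positivity)
  refine ⟨C, z, hz, ?_⟩
  have hout : ∀ x, (Circuit.output C - z • φ) x = Circuit.unitary C x (fun _ => false) -
      z * V x (fun _ => false) := fun x => by
    simp [Circuit.output, hVφ]
  refine lt_of_pow_lt_pow_left₀ 2 hη.le ?_
  rw [EuclideanSpace.norm_sq_eq]
  have h1 : ∑ x, ‖(Circuit.output C - z • φ) x‖ ^ 2 ≤ N * (η / (N + 1)) ^ 2 := by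
    have : N * (η / (N + 1)) ^ 2 = ∑ _x : Fin n → Bool, (η / (N + 1)) ^ 2 := by
      rw [Finset.sum_const, nsmul_eq_mul, Finset.card_univ]
    rw [this]
    refine Finset.sum_le_sum fun x _ => ?_
    rw [hout]
    exact pow_le_pow_left₀ (norm_nonneg _) (hC _ _) 2
  refine h1.trans_lt ?_
  rw [div_pow, ← mul_div_assoc, div_lt_iff₀ (by positivity), mul_comm]
  refine mul_lt_mul_of_pos_left ?_ (by positivity)
  nlinarith

/-! ### A fixed number of qubits -/

theorem ketbra_injective_of_linearIndependent {n : ℕ} {ι : Type*} {f : ι → Qubits n} (hf : LinearIndependent ℂ f)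
    (h1 : ∀ i, ‖f i‖ = 1) : Function.Injective fun i => ketbra (f i) := by
  intro i j h
  have hv : ∀ v w : Qubits n, Matrix.toEuclideanLin (ketbra v) w = (inner ℂ v w : ℂ) • v := by
    intro v w
    ext x
    change ∑ y, v x * star (v y) * w y = inner ℂ v w * v x
    rw [PiLp.inner_apply, Finset.sum_mul]
    refine Finset.sum_congr rfl fun y _ => ?_
    rw [RCLike.inner_apply]
    change _ = _ * star _ * _
    ring
  have h2 := congrArg (fun A => Matrix.toEuclideanLin A (f j)) h
  simp only [hv] at h2
  have h3 : (inner ℂ (f j) (f j) : ℂ) = 1 := by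
    rw [inner_self_eq_norm_sq_to_K, h1]
    simp
  rw [h3] at h2
  exact (hf.eq_of_smul_apply_eq_smul_apply 1 _ j i one_ne_zero h2.symm).symm

/-- For one fixed `n` no search is needed. Choose a basis of the span of all circuit outputs among
the outputs themselves: finitely many programs bound the complexities by `c`, injectivity of φ ↦
(⟨b_v,φ⟩)_v on a finite-dimensional space gives the frame constant `t`, and μ vanishes on the
orthogonal complement. Universality of the gates plays no role. -/
theorem exists_le_overlap_of_fixed {U : List Bool →. List Bool} (hU : IsUniversalMachine U)
    (B : GateSet) (n : ℕ) : ∃ c t : ℝ, 0 < t ∧ ∀ ε γ r s : ℝ, 0 ≤ ε → ε ≤ 1 → 0 ≤ γ → c ≤ s →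
      ∀ ψ : Qubits n, ‖ψ‖ = 1 → HbarSmooth U B (1 - ε) ψ ≤ (r : EReal) →
        1 - √(2 * ε) - γ * (4 / t) ≤ overlap ψ (easyRobustSpan U B n s γ) := by
  classical
  obtain ⟨b, hb, hspan, hli⟩ := exists_linearIndependent ℂ
    (Set.range (Circuit.output : Circuit B n → Qubits n))
  have : Finite b := hli.finite
  have := Fintype.ofFinite b
  choose C hC using fun v : b => hb v.2
  choose q hq using fun v : b => hU.exists_program (Circuit.description (C v))
  have hb1 : ∀ v : b, ‖(v : Qubits n)‖ = 1 := fun v => by rw [← hC v, norm_output]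
  have hrange : Set.range (Subtype.val : b → Qubits n) = b := Subtype.range_coe
  let T := Submodule.span ℂ b
  let L : T →ₗ[ℂ] EuclideanSpace ℂ b :=
    { toFun := fun φ => WithLp.toLp 2 fun v => inner ℂ (v : Qubits n) (φ : Qubits n)
      map_add' := fun φ φ' => by
        ext v
        simp
      map_smul' := fun z φ => by
        ext v
        simp }
  have hL : ∀ (φ : T) (v : b), L φ v = inner ℂ (v : Qubits n) (φ : Qubits n) := fun _ _ => rfl
  have hker : LinearMap.ker L = ⊥ := by
    rw [LinearMap.ker_eq_bot']
    intro φ hφ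
    have h1 : (φ : Qubits n) ∈ Tᗮ := by
      have h0 : T = Submodule.span ℂ (Set.range (Subtype.val : b → Qubits n)) := by rw [hrange]
      rw [Submodule.mem_orthogonal]
      intro u hu
      induction hu using Submodule.span_induction with
      | mem x hx =>
        have := hL φ ⟨x, hx⟩
        rw [hφ] at this
        exact this.symm
      | zero => simp
      | add x y _ _ hx hy => rw [inner_add_left, hx, hy, add_zero]
      | smul a x _ hx => rw [inner_smul_left, hx, mul_zero]
    have h2 := Submodule.inner_right_of_mem_orthogonal φ.2 h1
    exact Subtype.ext (inner_self_eq_zero.1 h2)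
  obtain ⟨κ, hκ, hanti⟩ := L.exists_antilipschitzWith hker
  have hκ' : (0 : ℝ) < κ := hκ
  refine ⟨∑ v, ((q v).length : ℝ), ((κ : ℝ) ^ 2)⁻¹, by positivity, ?_⟩
  intro ε γ r s hε0 hε1 hγ hs ψ hψ hr
  refine le_overlap_easyRobustSpan hU.1 hε0 hε1 hγ (by positivity) hψ hr
    (Subtype.val : b → Qubits n) (fun v => ?_) (ketbra_injective_of_linearIndependent hli hb1) (fun φ hφ => ?_)
    fun φ hφ _ => ?_
  · have h1 := ketbra_output_mem_easyStates (hq v) (s := s) (le_trans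
      (Finset.single_le_sum (f := fun v => ((q v).length : ℝ)) (fun _ _ => by positivity)
        (Finset.mem_univ v)) hs)
    rwa [hC v] at h1
  · rw [hrange] at hφ
    have h1 := hanti.le_mul_norm (map_zero L) ⟨φ, hφ⟩
    have h2 : ‖φ‖ ^ 2 ≤ (κ : ℝ) ^ 2 * ‖L ⟨φ, hφ⟩‖ ^ 2 := by
      rw [← mul_pow]
      exact pow_le_pow_left₀ (norm_nonneg _) h1 2
    rw [EuclideanSpace.norm_sq_eq (L _)] at h2
    rw [inv_mul_le_iff₀ (by positivity)]
    refine h2.trans (le_of_eq ?_)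
    congr 1
    refine Finset.sum_congr rfl fun v _ => ?_
    rw [hL, norm_inner_symm]
  · rw [hrange, hspan] at hφ
    have h0 : expect (semiDensity U B n) φ = 0 := by
      refine (hasSum_expect_semiDensity hU.1 φ).unique ?_
      convert hasSum_zero using 2 with x
      rw [Submodule.inner_left_of_mem_orthogonal
        (Submodule.subset_span (Set.mem_range_self x.1.2)) hφ]
      simp
    rw [h0]
    positivity

open Nat.Partrec (Code)

/-! ### Enumeration of the universal semi-density matrix -/

section

variable {α : Type} [Primcodable α]

@[fun_prop]
theorem computable_evaln' (c : Code) {f g : α → ℕ} (hf : Computable f) (hg : Computable g) :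
    Computable fun a => Code.evaln (f a) c (g a) :=
  (Code.primrec_evaln.to_comp).comp ((hf.pair (Computable.const c)).pair hg)

theorem computable_size : Computable Nat.size := by
  have h : ∀ n : ℕ, ∃ m, n < 2 ^ m := fun n => ⟨n, Nat.lt_two_pow_self⟩
  have h2 : ComputablePred fun p : ℕ × ℕ => p.1 < 2 ^ p.2 :=
    Computable.computablePred (p := fun p : ℕ × ℕ => p.1 < 2 ^ p.2)
      (computable_decide_lt (by fun_prop) (by fun_prop))
  refine (Computable.find h2 h).of_eq fun n => ?_
  rw [Nat.find_eq_iff]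
  exact ⟨Nat.lt_size_self n, fun m hm => by
    rw [not_lt]
    exact Nat.lt_size.1 hm⟩

theorem map_testBit_range_size (n : ℕ) : (List.range n.size).map n.testBit = n.bits := by
  refine List.ext_getElem (by simp [Nat.size_eq_bits_len]) fun i h1 h2 => ?_
  rw [List.getElem_map, List.getElem_range, Nat.testBit_eq_inth, List.getI_eq_getElem _ h2]

@[fun_prop]
theorem computable_bits' {f : α → ℕ} (hf : Computable f) :
    Computable fun a => Nat.bits (f a) := by
  have h : Computable fun n : ℕ => (List.range n.size).map fun i => n.testBit i :=
    computable_map_range computable_size (by fun_prop)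
  exact (h.of_eq map_testBit_range_size).comp hf

end

/-- The pair of a program and a circuit with a given code. -/
def programPair (q : ℕ) : List Bool × RawCircuit := (Encodable.decode q).getD ([], (0, []))

/-- Within `t` steps the `q`-th pair of a program and a circuit on `n` qubits is found to be in the
graph of the machine with code `c`. -/
def isListed (B : GateSet) (c : Code) (n q t : ℕ) : Bool :=
  -- This test rejects every `q` that is not the code of its own decoding, including those sent to
  -- the default pair, so each pair is counted once.
  (Encodable.encode (programPair q) == q) && (((programPair q).2.1 == n) &&
    (isCircuit B (programPair q).2 &&
      (Code.evaln t c (Encodable.encode (programPair q).1) ==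
        some (Encodable.encode (Nat.bits (Encodable.encode (programPair q).2))))))

def massTerm (B : GateSet) (C : RawCircuit) (q : ℕ) : ℂ :=
  ((2 : ℂ) ^ (programPair q).1.length)⁻¹ *
    (rawInner B (C, (programPair q).2) * star (rawInner B (C, (programPair q).2)))

/-- The lower approximations of the expectation value of the universal semi-density matrix. -/
def partialMass (B : GateSet) (c : Code) (x : ℕ × RawCircuit × ℕ) : ℂ :=
  ∑ q ∈ Finset.range x.2.2, if isListed B c x.1 q x.2.2 = true then massTerm B x.2.1 q else 0

theorem computable_programPair : Computable programPair := by
  unfold programPair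
  fun_prop

theorem isComputableFun_partialMass {B : GateSet} (hB : B.HasComputableAmplitudes) (c : Code) :
    IsComputableFun (partialMass B c) := by
  have h1 := computable_programPair
  have h2 := computable_isCircuit B
  have h3 : IsComputableFun fun p : (ℕ × RawCircuit × ℕ) × ℕ =>
      rawInner B (p.1.2.1, (programPair p.2).2) :=
    (isComputableFun_rawInner hB).comp
      (g := fun p : (ℕ × RawCircuit × ℕ) × ℕ => (p.1.2.1, (programPair p.2).2)) (by fun_prop)
  refine IsComputableFun.range_sum (H := fun p : (ℕ × RawCircuit × ℕ) × ℕ =>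
    if isListed B c p.1.1 p.2 p.1.2.2 = true then massTerm B p.1.2.1 p.2 else 0) ?_ (by fun_prop)
  refine IsComputableFun.cond ?_ ?_
    ((IsComputableFun.of_nat (Computable.const 0)).of_eq fun a => by simp)
  · unfold isListed
    fun_prop
  · exact (IsComputableFun.inv_two_pow (f := fun p : (ℕ × RawCircuit × ℕ) × ℕ =>
      (programPair p.2).1.length) (by fun_prop)).mul (h3.mul h3.conj)

section Enumeration

variable {U : List Bool →. List Bool} {B : GateSet} {n : ℕ} {c : Code}

/-- `c` is a code of the partial function `U`. -/
def IsCodeOf (c : Code) (U : List Bool →. List Bool) : Prop :=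
  ∀ p x, x ∈ U p ↔ Encodable.encode x ∈ c.eval (Encodable.encode p)

theorem exists_isCodeOf (hU : Partrec U) : ∃ c, IsCodeOf c U := by
  obtain ⟨c, hc⟩ := Code.exists_code.1 hU
  refine ⟨c, fun p x => ?_⟩
  rw [hc]
  simp

def Programs.code (x : Programs U B n) : ℕ := Encodable.encode (x.1.1, x.1.2.raw)

theorem programPair_code (x : Programs U B n) : programPair x.code = (x.1.1, x.1.2.raw) := by
  rw [programPair, Programs.code, Encodable.encodek, Option.getD_some]

theorem raw_injective : Function.Injective (Circuit.raw (B := B) (n := n)) := fun C D h =>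
  description_injective (by
    change Nat.bits (Encodable.encode C.raw) = Nat.bits (Encodable.encode D.raw)
    rw [h])

theorem code_injective : Function.Injective (Programs.code (U := U) (B := B) (n := n)) := by
  intro x y h
  have h2 := Encodable.encode_injective h
  simp only [Prod.mk.injEq] at h2
  exact Subtype.ext (Prod.ext h2.1 (raw_injective h2.2))

theorem isListed_iff (hc : IsCodeOf c U) {q t : ℕ} : isListed B c n q t = true ↔
    ∃ x : Programs U B n, x.code = q ∧ Encodable.encode (Circuit.description x.1.2) ∈
      Code.evaln t c (Encodable.encode x.1.1) := by
  simp only [isListed, Bool.and_eq_true, beq_iff_eq]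
  constructor
  · rintro ⟨h1, h2, h3, h4⟩
    obtain ⟨C, hC⟩ := isCircuit_iff.1 h3
    subst h2
    have h5 : Circuit.description C = Nat.bits (Encodable.encode (programPair q).2) := by
      exact congrArg (fun S : RawCircuit => Nat.bits (Encodable.encode S)) hC
    rw [← h5] at h4
    refine ⟨⟨((programPair q).1, C), ?_⟩, ?_, h4⟩
    · exact (hc _ _).2 (Code.evaln_sound h4)
    · rw [Programs.code]
      change Encodable.encode ((programPair q).1, C.raw) = q
      rw [hC]
      exact h1
  · rintro ⟨x, rfl, hx⟩
    rw [programPair_code]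
    exact ⟨rfl, rfl, isCircuit_iff.2 ⟨x.1.2, rfl⟩, hx⟩

theorem massTerm_code (C : Circuit B n) (x : Programs U B n) :
    massTerm B C.raw x.code = ((((2 : ℝ) ^ x.1.1.length)⁻¹ *
      ‖(inner ℂ (Circuit.output C) (Circuit.output x.1.2) : ℂ)‖ ^ 2 : ℝ) : ℂ) := by
  rw [massTerm, programPair_code]
  simp only
  rw [rawInner_raw, Complex.star_def, Complex.mul_conj, Complex.normSq_eq_norm_sq]
  push_cast
  rfl

/-- Lower semicomputability of μ: `partialMass` at stage `t` is a finite partial sum of a convergent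
series of nonnegative terms, and every finite set of programs is listed at some stage. -/
theorem lt_expect_semiDensity_iff (hU : IsPrefixFreeMachine U) (hc : IsCodeOf c U)
    (C : Circuit B n) (a : ℝ) : a < expect (semiDensity U B n) (Circuit.output C) ↔
      ∃ t, a < (partialMass B c (n, C.raw, t)).re := by
  classical
  set w : Programs U B n → ℝ := fun x => ((2 : ℝ) ^ x.1.1.length)⁻¹ *
      ‖(inner ℂ (Circuit.output C) (Circuit.output x.1.2) : ℂ)‖ ^ 2 with hw
  have hw0 : ∀ x, 0 ≤ w x := fun x => by positivity
  have hsum : HasSum w (expect (semiDensity U B n) (Circuit.output C)) :=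
    hasSum_expect_semiDensity hU (Circuit.output C)
  let S : ℕ → Finset (Programs U B n) := fun t =>
    ((Finset.range t).filter fun q => isListed B c n q t = true).preimage Programs.code
      (code_injective.injOn)
  have hS : ∀ t, (partialMass B c (n, C.raw, t)).re = ∑ x ∈ S t, w x := fun t => by
    have h1 : ∀ x, w x = (massTerm B C.raw x.code).re := fun x => by
      rw [massTerm_code, Complex.ofReal_re]
    simp only [h1]
    rw [Finset.sum_preimage (f := Programs.code) _ _ fun q => (massTerm B C.raw q).re,
      Finset.sum_filter, partialMass, Complex.re_sum]
    · refine Finset.sum_congr rfl fun q _ => ?_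
      split_ifs <;> rfl
    · intro q hq hq2
      obtain ⟨x, hx, -⟩ := (isListed_iff hc).1 (Finset.mem_filter.1 hq).2
      exact absurd ⟨x, hx⟩ hq2
  simp only [hS]
  constructor
  · intro h
    obtain ⟨s, hs⟩ := (hsum.eventually_const_lt h).exists
    have h1 : ∀ x : Programs U B n, ∃ t, Encodable.encode (Circuit.description x.1.2) ∈
        Code.evaln t c (Encodable.encode x.1.1) := fun x =>
      Code.evaln_complete.1 ((hc _ _).1 x.2)
    choose T hT using h1
    -- The stage must exceed both the running times and the codes of all programs in `s`.
    refine ⟨s.sup (fun x => max (T x) (x.code + 1)), hs.trans_le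
      (Finset.sum_le_sum_of_subset_of_nonneg (fun x hx => ?_) fun x _ _ => hw0 x)⟩
    have h2 := Finset.le_sup (f := fun x => max (T x) (x.code + 1)) hx
    rw [Finset.mem_preimage, Finset.mem_filter, Finset.mem_range, isListed_iff hc]
    exact ⟨(le_max_right _ _).trans h2, x, rfl,
      Code.evaln_mono ((le_max_left _ _).trans h2) (hT x)⟩
  · rintro ⟨t, ht⟩
    exact ht.trans_le (sum_le_hasSum _ (fun x _ => hw0 x) hsum)

end Enumeration

/-! ### The search for nearly orthogonal circuits -/

section Search

variable {U : List Bool →. List Bool} {B : GateSet}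

/-- The circuit `C` has large expectation value and is nearly orthogonal to the circuits in `L`. -/
def IsGood (U : List Bool →. List Bool) (B : GateSet) (n k : ℕ) (L : List RawCircuit)
    (C : Circuit B n) : Prop :=
  -- The shift by 2^-n makes every state pass this test at k = n + 1, so larger k are never needed
  -- and k can be described in O(log n) bits. It adds only 1 to the trace.
  ((2 : ℝ) ^ k)⁻¹ < expect (semiDensity U B n) (Circuit.output C) + ((2 : ℝ) ^ n)⁻¹ ∧
    ∑ i ∈ Finset.range L.length, ‖rawInner B (L.getD i (0, []), C.raw)‖ ^ 2 <
      (1 / 4) ^ (L.length + 2)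

/-- Both conditions in `IsGood` are positivity of computable quantities, the first after an
existential over stages, so goodness has a finite checkable witness. Unbounded search runs over
circuits and witnesses together. -/
theorem exists_search (hU : IsPrefixFreeMachine U) (hB : B.HasComputableAmplitudes) :
    ∃ next : ℕ × ℕ × List RawCircuit →. RawCircuit, Partrec next ∧
      (∀ n k L S, S ∈ next (n, k, L) → ∃ C : Circuit B n, C.raw = S ∧ IsGood U B n k L C) ∧
      ∀ n k L, (∃ C : Circuit B n, IsGood U B n k L C) → (next (n, k, L)).Dom := by
  obtain ⟨c, hc⟩ := exists_isCodeOf hU.1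
  have h1 : IsComputableFun fun x : (ℕ × ℕ × List RawCircuit) × RawCircuit × ℕ =>
      partialMass B c (x.1.1, x.2.1, x.2.2) + ((2 : ℂ) ^ x.1.1)⁻¹ - ((2 : ℂ) ^ x.1.2.1)⁻¹ :=
    (((isComputableFun_partialMass hB c).comp
      (g := fun x : (ℕ × ℕ × List RawCircuit) × RawCircuit × ℕ => (x.1.1, x.2.1, x.2.2))
      (by fun_prop)).add (IsComputableFun.inv_two_pow (by fun_prop))).sub
      (IsComputableFun.inv_two_pow (by fun_prop))
  have h2 : IsComputableFun fun x : ((ℕ × ℕ × List RawCircuit) × RawCircuit) × ℕ =>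
      rawInner B (x.1.1.2.2.getD x.2 (0, []), x.1.2) :=
    (isComputableFun_rawInner hB).comp
      (g := fun x : ((ℕ × ℕ × List RawCircuit) × RawCircuit) × ℕ =>
        (x.1.1.2.2.getD x.2 (0, []), x.1.2)) (by fun_prop)
  have h3 : IsComputableFun fun x : (ℕ × ℕ × List RawCircuit) × RawCircuit =>
      ((2 : ℂ) ^ (2 * (x.1.2.2.length + 2)))⁻¹ - ∑ i ∈ Finset.range x.1.2.2.length,
        rawInner B (x.1.2.2.getD i (0, []), x.2) * star (rawInner B (x.1.2.2.getD i (0, []), x.2)) :=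
    (IsComputableFun.inv_two_pow (by fun_prop)).sub
      (IsComputableFun.range_sum (h2.mul h2.conj) (by fun_prop))
  obtain ⟨T₁, hT₁, hT₁'⟩ := h1.exists_test
  obtain ⟨T₂, hT₂, hT₂'⟩ := h3.exists_test
  -- A candidate consists of a circuit, a stage for `partialMass` and one precision for each
  -- positivity test. The default is harmless, as it is tested like any other candidate.
  let cand : ℕ → RawCircuit × ℕ × ℕ × ℕ := fun w => (Encodable.decode w).getD ((0, []), 0, 0, 0)
  let test : (ℕ × ℕ × List RawCircuit) → ℕ → Bool := fun x w =>
    ((cand w).1.1 == x.1) && (isCircuit B (cand w).1 &&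
      (T₁ ((x, (cand w).1, (cand w).2.1), (cand w).2.2.1) &&
        T₂ ((x, (cand w).1), (cand w).2.2.2)))
  have hcand : Computable cand := by
    simp only [cand]
    fun_prop
  have htest : Computable fun p : (ℕ × ℕ × List RawCircuit) × ℕ => test p.1 p.2 := by
    have := computable_isCircuit B
    simp only [test]
    fun_prop
  have hgood : ∀ (n k : ℕ) (L : List RawCircuit) (C : Circuit B n), IsGood U B n k L C ↔
      (∃ t m, T₁ (((n, k, L), C.raw, t), m) = true) ∧ ∃ m, T₂ (((n, k, L), C.raw), m) = true := by
    intro n k L C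
    simp only [← hT₁', ← hT₂', IsGood]
    refine and_congr ?_ ?_
    · rw [← sub_lt_iff_lt_add, lt_expect_semiDensity_iff hU hc]
      refine exists_congr fun t => ?_
      have e : ∀ j : ℕ, ((2 : ℂ) ^ j)⁻¹.re = ((2 : ℝ) ^ j)⁻¹ := fun j => by
        have : ((2 : ℂ) ^ j)⁻¹ = (((2 : ℝ) ^ j)⁻¹ : ℝ) := by push_cast; rfl
        rw [this, Complex.ofReal_re]
      rw [Complex.sub_re, Complex.add_re, e, e]
      constructor <;> intro h <;> linarith
    · have e : ((2 : ℂ) ^ (2 * (L.length + 2)))⁻¹ = (((1 / 4 : ℝ) ^ (L.length + 2) : ℝ) : ℂ) := by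
        rw [pow_mul]
        push_cast
        rw [one_div, inv_pow]
        norm_num
      rw [Complex.sub_re, e, Complex.ofReal_re, Complex.re_sum, sub_pos]
      refine Iff.of_eq (congrArg₂ _ (Finset.sum_congr rfl fun i _ => ?_) rfl)
      rw [Complex.star_def, Complex.mul_conj, Complex.ofReal_re, Complex.normSq_eq_norm_sq]
  refine ⟨fun x => (Nat.rfind fun w => Part.some (test x w)).map fun w => (cand w).1, ?_, ?_, ?_⟩
  · refine Partrec.map (Partrec.rfind (p := fun x w => Part.some (test x w)) ?_) ?_
    · exact Computable.partrec htest
    · change Computable fun p : (ℕ × ℕ × List RawCircuit) × ℕ => (cand p.2).1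
      fun_prop
  · intro n k L S hS
    obtain ⟨w, hw, rfl⟩ := (Part.mem_map_iff _).1 hS
    have h := (Part.mem_some_iff.1 (Nat.rfind_spec hw)).symm
    simp only [test, Bool.and_eq_true, beq_iff_eq] at h
    obtain ⟨h4, h5, h6, h7⟩ := h
    subst h4
    obtain ⟨C, hC⟩ := isCircuit_iff.1 h5
    rw [← hC] at h6 h7
    exact ⟨C, hC, (hgood _ k L C).2 ⟨⟨_, _, h6⟩, ⟨_, h7⟩⟩⟩
  · rintro n k L ⟨C, hC⟩
    obtain ⟨⟨t, m, h6⟩, m', h7⟩ := (hgood n k L C).1 hC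
    change (Nat.rfind fun w => Part.some (test (n, k, L) w)).Dom
    refine Nat.rfind_dom.2 ⟨Encodable.encode (C.raw, t, m, m'), ?_, fun _ => trivial⟩
    refine Part.mem_some_iff.2 ?_
    have e : cand (Encodable.encode (C.raw, t, m, m')) = (C.raw, t, m, m') := by
      simp only [cand, Encodable.encodek, Option.getD_some]
    simp only [test, e]
    have h8 : C.raw.1 = n := rfl
    have h9 : isCircuit B C.raw = true := isCircuit_iff.2 ⟨C, rfl⟩
    simp [h8, h9, h6, h7]

end Search

/-! ### Iterating the search -/

/-- The first `m` circuits that the search finds for the parameters `x = (n, k)`. -/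
def searchSeq (next : ℕ × ℕ × List RawCircuit →. RawCircuit) (x : ℕ × ℕ) (m : ℕ) :
    Part (List RawCircuit) :=
  Nat.rec (Part.some []) (fun _ l => l.bind fun L =>
    (next (x.1, x.2, L)).map fun S => L ++ [S]) m

section SearchSeq

variable {next : ℕ × ℕ × List RawCircuit →. RawCircuit} {x : ℕ × ℕ}

theorem partrec_searchSeq (hnext : Partrec next) :
    Partrec fun p : (ℕ × ℕ) × ℕ => searchSeq next p.1 p.2 := by
  refine Partrec.nat_rec (f := fun p : (ℕ × ℕ) × ℕ => p.2)
    (g := fun _ => Part.some ([] : List RawCircuit))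
    (h := fun p q => (next (p.1.1, p.1.2, q.2)).map fun S => q.2 ++ [S])
    Computable.snd (Computable.const _) ?_
  refine Partrec.map (f := fun z : ((ℕ × ℕ) × ℕ) × ℕ × List RawCircuit =>
    next (z.1.1.1, z.1.1.2, z.2.2)) (g := fun z S => z.2.2 ++ [S]) (hnext.comp (by fun_prop)) ?_
  change Computable fun z : (((ℕ × ℕ) × ℕ) × ℕ × List RawCircuit) × RawCircuit =>
    z.1.2.2 ++ [z.2]
  fun_prop

theorem mem_searchSeq_succ {m : ℕ} {L : List RawCircuit} :
    L ∈ searchSeq next x (m + 1) ↔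
      ∃ L' ∈ searchSeq next x m, ∃ S ∈ next (x.1, x.2, L'), L' ++ [S] = L := by
  change L ∈ (searchSeq next x m).bind _ ↔ _
  simp only [Part.mem_bind_iff, Part.mem_map_iff]

theorem searchSeq_spec {m : ℕ} {L : List RawCircuit} (hL : L ∈ searchSeq next x m) :
    L.length = m ∧ ∀ i < m, L.take (i + 1) ∈ searchSeq next x (i + 1) ∧
      L.getD i (0, []) ∈ next (x.1, x.2, L.take i) := by
  induction m generalizing L with
  | zero =>
    obtain rfl : L = [] := Part.mem_some_iff.1 hL
    simp
  | succ m ih =>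
    obtain ⟨L', hL', S, hS, rfl⟩ := mem_searchSeq_succ.1 hL
    obtain ⟨h1, h2⟩ := ih hL'
    refine ⟨by simp [h1], fun i hi => ?_⟩
    rcases Nat.lt_succ_iff_lt_or_eq.1 hi with h | rfl
    · obtain ⟨h3, h4⟩ := h2 i h
      rw [List.take_append_of_le_length (by omega), List.take_append_of_le_length (by omega),
        List.getD_append _ _ _ _ (by omega)]
      exact ⟨h3, h4⟩
    · subst h1
      refine ⟨?_, ?_⟩
      · rw [List.take_of_length_le (by simp)]
        exact hL
      · rw [List.take_append_of_le_length le_rfl, List.take_length]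
        simpa [List.getD_eq_getElem?_getD] using hS

end SearchSeq

/-! ### A prefix-free machine -/

/-- A self-delimiting description of `e < 2 ^ s` and of `i < 2 ^ (k + 2)`, where `k` is the second
component of the pair that `e` encodes. -/
def programCode (s e i : ℕ) : List Bool :=
  (List.range s).map (fun _ => true) ++ (false :: ((List.range s).map (fun j => e.testBit j) ++
    (List.range (e.unpair.2 + 2)).map fun j => i.testBit j))

theorem programCode_length (s e i : ℕ) :
    (programCode s e i).length = 2 * s + 1 + (e.unpair.2 + 2) := by
  simp [programCode]
  omega

theorem map_testBit_injective {w a b : ℕ} (ha : a < 2 ^ w) (hb : b < 2 ^ w)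
    (h : (List.range w).map (fun j => a.testBit j) = (List.range w).map fun j => b.testBit j) :
    a = b := by
  refine Nat.eq_of_testBit_eq fun j => ?_
  by_cases hj : j < w
  · exact List.map_inj_left.1 h j (List.mem_range.2 hj)
  · have hp : 2 ^ w ≤ 2 ^ j := Nat.pow_le_pow_right (by norm_num) (not_lt.1 hj)
    rw [Nat.testBit_lt_two_pow (ha.trans_le hp), Nat.testBit_lt_two_pow (hb.trans_le hp)]

theorem replicate_append_prefix {s s' : ℕ} {l l' : List Bool}
    (h : List.replicate s true ++ false :: l <+: List.replicate s' true ++ false :: l') :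
    s = s' ∧ l <+: l' := by
  induction s generalizing s' with
  | zero =>
    cases s' with
    | zero => simpa using h
    | succ s' => simp [List.replicate_succ] at h
  | succ s ih =>
    cases s' with
    | zero => simp [List.replicate_succ] at h
    | succ s' =>
      simp only [List.replicate_succ, List.cons_append, List.cons_prefix_cons, true_and] at h
      exact ⟨congrArg Nat.succ (ih h).1, (ih h).2⟩

theorem append_prefix_of_length_eq {a a' b b' : List Bool} (hl : a.length = a'.length)
    (h : a ++ b <+: a' ++ b') : a = a' ∧ b <+: b' := by
  obtain ⟨t, ht⟩ := h
  rw [List.append_assoc] at ht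
  obtain ⟨h1, h2⟩ := List.append_inj ht hl
  exact ⟨h1, t, h2⟩

/-- The unary block delimits `s`, hence the block of `e`, and `e` contains k, which fixes the length
of the last block. Thus `i` costs only k + 2 bits, with no delimiter of its own. -/
theorem programCode_prefix {s e i s' e' i' : ℕ} (he : e < 2 ^ s) (he' : e' < 2 ^ s')
    (hi : i < 2 ^ (e.unpair.2 + 2)) (hi' : i' < 2 ^ (e'.unpair.2 + 2))
    (h : programCode s e i <+: programCode s' e' i') : s = s' ∧ e = e' ∧ i = i' := by
  simp only [programCode, List.map_const', List.length_range] at h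
  obtain ⟨rfl, h1⟩ := replicate_append_prefix h
  obtain ⟨h2, h3⟩ := append_prefix_of_length_eq (by simp) h1
  obtain rfl := map_testBit_injective he he' h2
  have h4 := h3.eq_of_length (by simp)
  exact ⟨rfl, rfl, map_testBit_injective hi hi' h4⟩

/-- The machine parses its program into (n, k) and i and runs the search just far enough to see
circuit number i. It need not know when the search gets stuck. -/
theorem exists_machine {next : ℕ × ℕ × List RawCircuit →. RawCircuit} (hnext : Partrec next) :
    ∃ V, IsPrefixFreeMachine V ∧ ∀ n k s m L, Nat.pair n k < 2 ^ s →
      L ∈ searchSeq next (n, k) m → ∀ i < m, i < 2 ^ (k + 2) →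
        ∃ p, p.length = 2 * s + 1 + (k + 2) ∧
          Nat.bits (Encodable.encode (L.getD i (0, []))) ∈ V p := by
  let dec : ℕ → ℕ × ℕ × ℕ := fun w => (Encodable.decode w).getD (0, 0, 0)
  let test : List Bool → ℕ → Bool := fun p w =>
    decide ((dec w).2.1 < 2 ^ (dec w).1) &&
      (decide ((dec w).2.2 < 2 ^ ((dec w).2.1.unpair.2 + 2)) &&
        (programCode (dec w).1 (dec w).2.1 (dec w).2.2 == p))
  have hdec : Computable dec := by
    simp only [dec]
    fun_prop
  have hcode : Computable fun w => programCode (dec w).1 (dec w).2.1 (dec w).2.2 := by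
    have h1 : Computable fun w => (List.range (dec w).1).map fun _ => true :=
      computable_map_range (by fun_prop) (by fun_prop)
    have h2 : Computable fun w => (List.range (dec w).1).map fun j => (dec w).2.1.testBit j :=
      computable_map_range (by fun_prop) (by fun_prop)
    have h3 : Computable fun w => (List.range ((dec w).2.1.unpair.2 + 2)).map
        fun j => (dec w).2.2.testBit j :=
      computable_map_range (by fun_prop) (by fun_prop)
    exact computable_append' h1
      (computable_cons' (computable_const' false) (computable_append' h2 h3))
  have htest : Computable fun z : List Bool × ℕ => test z.1 z.2 := by
    have h1 : Computable fun z : List Bool × ℕ =>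
      programCode (dec z.2).1 (dec z.2).2.1 (dec z.2).2.2 := hcode.comp Computable.snd
    have h2 : Computable fun z : List Bool × ℕ =>
        programCode (dec z.2).1 (dec z.2).2.1 (dec z.2).2.2 == z.1 :=
      computable_beq' h1 Computable.fst
    have h3 : Computable fun z : List Bool × ℕ => decide ((dec z.2).2.1 < 2 ^ (dec z.2).1) := by
      fun_prop
    have h4 : Computable fun z : List Bool × ℕ =>
        decide ((dec z.2).2.2 < 2 ^ ((dec z.2).2.1.unpair.2 + 2)) := by
      fun_prop
    exact computable_and' h3 (computable_and' h4 h2)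
  let V : List Bool →. List Bool := fun p =>
    (Nat.rfind fun w => Part.some (test p w)).bind fun w =>
      -- Indices start at 0, so i + 1 rounds are run; a further round might diverge.
      (searchSeq next (dec w).2.1.unpair ((dec w).2.2 + 1)).map fun L =>
        Nat.bits (Encodable.encode (L.getD (dec w).2.2 (0, [])))
  have hspec : ∀ p w, w ∈ (Nat.rfind fun w => Part.some (test p w)) →
      (dec w).2.1 < 2 ^ (dec w).1 ∧ (dec w).2.2 < 2 ^ ((dec w).2.1.unpair.2 + 2) ∧
        programCode (dec w).1 (dec w).2.1 (dec w).2.2 = p := by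
    intro p w hw
    have h := (Part.mem_some_iff.1 (Nat.rfind_spec hw)).symm
    simpa only [test, Bool.and_eq_true, decide_eq_true_eq, beq_iff_eq] using h
  refine ⟨V, ⟨?_, ?_⟩, ?_⟩
  · refine Partrec.bind (Partrec.rfind (p := fun p w => Part.some (test p w)) ?_) ?_
    · exact Computable.partrec htest
    · refine Partrec.map (f := fun z : List Bool × ℕ =>
        searchSeq next (dec z.2).2.1.unpair ((dec z.2).2.2 + 1))
        (g := fun z L => Nat.bits (Encodable.encode (L.getD (dec z.2).2.2 (0, [])))) ?_ ?_
      · exact (partrec_searchSeq hnext).comp (g := fun z : List Bool × ℕ =>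
          ((dec z.2).2.1.unpair, (dec z.2).2.2 + 1)) (by fun_prop)
      · change Computable fun z : (List Bool × ℕ) × List RawCircuit =>
          Nat.bits (Encodable.encode (z.2.getD (dec z.1.2).2.2 (0, [])))
        fun_prop
  · intro p q hp hq hpq
    obtain ⟨w, hw, -⟩ := Part.mem_bind_iff.1 (Part.get_mem hp)
    obtain ⟨w', hw', -⟩ := Part.mem_bind_iff.1 (Part.get_mem hq)
    obtain ⟨h1, h2, rfl⟩ := hspec _ _ hw
    obtain ⟨h3, h4, rfl⟩ := hspec _ _ hw'
    obtain ⟨h5, h6, h7⟩ := programCode_prefix h1 h3 h2 h4 hpq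
    rw [h5, h6, h7]
  · intro n k s m L he hL i him hi
    refine ⟨programCode s (Nat.pair n k) i, by rw [programCode_length, Nat.unpair_pair], ?_⟩
    have hdom : (Nat.rfind fun w => Part.some (test (programCode s (Nat.pair n k) i) w)).Dom := by
      refine Nat.rfind_dom.2 ⟨Encodable.encode (s, Nat.pair n k, i), ?_, fun _ => trivial⟩
      refine Part.mem_some_iff.2 ?_
      have e : dec (Encodable.encode (s, Nat.pair n k, i)) = (s, Nat.pair n k, i) := by
        simp only [dec, Encodable.encodek, Option.getD_some]
      simp only [test, e, Nat.unpair_pair]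
      simp [he, hi]
    obtain ⟨w, hw⟩ := Part.dom_iff_mem.1 hdom
    obtain ⟨h1, h2, h3⟩ := hspec _ _ hw
    obtain ⟨h5, h6, h7⟩ := programCode_prefix h1 he h2 (by rwa [Nat.unpair_pair])
      ⟨[], by rw [List.append_nil, h3]⟩
    refine Part.mem_bind_iff.2 ⟨w, hw, ?_⟩
    rw [h6, h7, Nat.unpair_pair]
    refine (Part.mem_map_iff _).2 ⟨_, ((searchSeq_spec hL).2 i him).1, ?_⟩
    have hlen : i < L.length := (searchSeq_spec hL).1.symm ▸ him
    congr 2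
    simp [List.getD_eq_getElem?_getD]

/-! ### The number of circuits found by the search -/

section Count

variable {U : List Bool →. List Bool} {B : GateSet} {n k m : ℕ} {f : Fin m → Qubits n}

/-- Sum the lower bounds on the expectations. Bessel with constant 3/2 and Kraft bound the part from
μ by 3/2; Bessel applied to the 2^n basis states gives m ≤ (3/2)·2^n, so the shifts also add at most
3/2. Hence m·2^-k ≤ 3. -/
theorem card_le_of_nearly_orthonormal (hU : IsPrefixFreeMachine U) (h1 : ∀ i, ‖f i‖ = 1)
    (hf : ∀ j, ∑ i with i < j, ‖(inner ℂ (f i) (f j) : ℂ)‖ ^ 2 ≤ (1 / 4) ^ ((j : ℕ) + 2))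
    (hk : ∀ i, ((2 : ℝ) ^ k)⁻¹ < expect (semiDensity U B n) (f i) + ((2 : ℝ) ^ n)⁻¹) :
    m ≤ 3 * 2 ^ k := by
  have hub := sum_norm_inner_sq_le_of_nearly_orthonormal h1 hf
  have hs1 : ∑ i, expect (semiDensity U B n) (f i) ≤ 3 / 2 := by
    have hw := kraft_programs (B := B) (n := n) hU
    refine (hasSum_le (fun x => ?_) (hasSum_sum fun i _ => hasSum_expect_semiDensity hU (f i))
      (hw.1.hasSum.mul_right (3 / 2))).trans ?_
    · rw [← Finset.mul_sum]
      refine mul_le_mul_of_nonneg_left ?_ (by positivity)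
      simpa [norm_output] using hub (Circuit.output x.1.2)
    · have := hw.2
      linarith
  have hs2 : (m : ℝ) ≤ 2 ^ n * (3 / 2) := by
    have e1 : (m : ℝ) = ∑ i, ‖f i‖ ^ 2 := by simp [h1]
    have e2 : ∑ i, ‖f i‖ ^ 2 = ∑ x : Fin n → Bool, ∑ i,
        ‖(inner ℂ (f i) (EuclideanSpace.single x (1 : ℂ)) : ℂ)‖ ^ 2 := by
      rw [Finset.sum_comm]
      refine Finset.sum_congr rfl fun i _ => ?_
      rw [EuclideanSpace.norm_sq_eq]
      refine Finset.sum_congr rfl fun x _ => ?_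
      rw [EuclideanSpace.inner_single_right, one_mul, RCLike.norm_conj]
    rw [e1, e2]
    refine (Finset.sum_le_sum fun x _ => hub _).trans (le_of_eq ?_)
    simp
  have hs3 : (m : ℝ) * ((2 : ℝ) ^ k)⁻¹ ≤ 3 := by
    have h2 : (m : ℝ) * ((2 : ℝ) ^ k)⁻¹ ≤
        ∑ i, (expect (semiDensity U B n) (f i) + ((2 : ℝ) ^ n)⁻¹) := by
      have : (m : ℝ) * ((2 : ℝ) ^ k)⁻¹ = ∑ _i : Fin m, ((2 : ℝ) ^ k)⁻¹ := by simp
      rw [this]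
      exact Finset.sum_le_sum fun i _ => (hk i).le
    rw [Finset.sum_add_distrib] at h2
    have h3 : ∑ _i : Fin m, ((2 : ℝ) ^ n)⁻¹ ≤ 3 / 2 := by
      rw [Finset.sum_const, Finset.card_univ, Fintype.card_fin, nsmul_eq_mul, ← div_eq_mul_inv,
        div_le_iff₀ (by positivity)]
      linarith
    linarith
  rw [← div_eq_mul_inv, div_le_iff₀ (by positivity)] at hs3
  exact_mod_cast hs3

end Count

section Found

variable {U : List Bool →. List Bool} {B : GateSet} {n k : ℕ}

/-- The circuits found by the search. -/
structure IsFound (U : List Bool →. List Bool) (B : GateSet) (n k : ℕ) (L : List RawCircuit)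
    (C : Fin L.length → Circuit B n) : Prop where
  raw : ∀ i, (C i).raw = L.getD i (0, [])
  lt_expect : ∀ i,
    ((2 : ℝ) ^ k)⁻¹ < expect (semiDensity U B n) (Circuit.output (C i)) + ((2 : ℝ) ^ n)⁻¹
  sum_le : ∀ j, ∑ i with i < j,
    ‖(inner ℂ (Circuit.output (C i)) (Circuit.output (C j)) : ℂ)‖ ^ 2 ≤ (1 / 4) ^ ((j : ℕ) + 2)

theorem exists_isFound {next : ℕ × ℕ × List RawCircuit →. RawCircuit}
    (hnext : ∀ n k L S, S ∈ next (n, k, L) → ∃ C : Circuit B n, C.raw = S ∧ IsGood U B n k L C)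
    {m : ℕ} {L : List RawCircuit} (hL : L ∈ searchSeq next (n, k) m) :
    ∃ C, IsFound U B n k L C := by
  obtain ⟨rfl, h⟩ := searchSeq_spec hL
  choose C hC hgood using fun i : Fin L.length => hnext n k _ _ (h i i.2).2
  refine ⟨C, hC, fun i => (hgood i).1, fun j => ?_⟩
  have h2 := (hgood j).2
  rw [List.length_take, min_eq_left j.2.le] at h2
  refine le_trans (le_of_eq ?_) h2.le
  refine Finset.sum_bij (fun i _ => (i : ℕ)) (fun i hi => ?_) (fun i _ i' _ hii => Fin.ext hii)
    (fun i hi => ?_) fun i hi => ?_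
  · exact Finset.mem_range.2 (Finset.mem_filter.1 hi).2
  · have hij := Finset.mem_range.1 hi
    exact ⟨⟨i, hij.trans j.2⟩, Finset.mem_filter.2 ⟨Finset.mem_univ _, Fin.lt_def.2 hij⟩, rfl⟩
  · have hij : (i : ℕ) < j := (Finset.mem_filter.1 hi).2
    have e : (L.take j).getD i (0, []) = (C i).raw := by
      rw [hC]
      simp [List.getD_eq_getElem?_getD, hij]
    rw [e, rawInner_raw]

/-- A vector orthogonal to the family that violated the bound would satisfy both strict conditions
of `IsGood`. These are open and invariant under phases, and circuit outputs are dense up to phase,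
so some circuit would be good too. -/
theorem expect_le_of_not_isGood {L : List RawCircuit} {C : Fin L.length → Circuit B n}
    (hC : IsFound U B n k L C)
    (hdense : ∀ φ : Qubits n, ‖φ‖ = 1 → ∀ η : ℝ, 0 < η →
      ∃ (C : Circuit B n) (z : ℂ), ‖z‖ = 1 ∧ ‖Circuit.output C - z • φ‖ < η)
    (hnot : ∀ D : Circuit B n, ¬ IsGood U B n k L D) {φ : Qubits n} (hφ1 : ‖φ‖ = 1)
    (hφ : φ ∈ (Submodule.span ℂ (Set.range fun i => Circuit.output (C i)))ᗮ) :
    expect (semiDensity U B n) φ + ((2 : ℝ) ^ n)⁻¹ ≤ ((2 : ℝ) ^ k)⁻¹ := by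
  by_contra hcon
  push Not at hcon
  set F : Qubits n → ℝ := fun v => ∑ i, ‖(inner ℂ (Circuit.output (C i)) v : ℂ)‖ ^ 2 with hF
  have hopen : IsOpen {v : Qubits n | ((2 : ℝ) ^ k)⁻¹ <
      expect (semiDensity U B n) v + ((2 : ℝ) ^ n)⁻¹ ∧ F v < (1 / 4) ^ (L.length + 2)} := by
    have h1 : Continuous fun v : Qubits n => expect (semiDensity U B n) v + ((2 : ℝ) ^ n)⁻¹ :=
      (continuous_expect _).add continuous_const
    have h2 : Continuous F := by
      simp only [hF]
      fun_prop
    exact (isOpen_lt continuous_const h1).inter (isOpen_lt h2 continuous_const)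
  have hFφ : F φ = 0 := by
    refine Finset.sum_eq_zero fun i _ => ?_
    have h : Circuit.output (C i) ∈
        Submodule.span ℂ (Set.range fun i => Circuit.output (C i)) :=
      Submodule.subset_span (Set.mem_range_self i)
    rw [Submodule.inner_right_of_mem_orthogonal h hφ]
    simp
  obtain ⟨η, hη, hball⟩ := Metric.isOpen_iff.1 hopen φ ⟨hcon, by rw [hFφ]; positivity⟩
  obtain ⟨D, z, hz, hD⟩ := hdense φ hφ1 η hη
  have hz0 : z ≠ 0 := by
    rintro rfl
    simp at hz
  have hzi : ‖z⁻¹‖ = 1 := by rw [norm_inv, hz, inv_one]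
  have hmem : z⁻¹ • Circuit.output D ∈ Metric.ball φ η := by
    rw [mem_ball_iff_norm]
    have : z⁻¹ • Circuit.output D - φ = z⁻¹ • (Circuit.output D - z • φ) := by
      rw [smul_sub, inv_smul_smul₀ hz0]
    rwa [this, norm_smul, hzi, one_mul]
  obtain ⟨h1, h2⟩ := hball hmem
  rw [expect_smul, hzi, one_pow, one_mul] at h1
  refine hnot D ⟨h1, lt_of_eq_of_lt ?_ h2⟩
  rw [hF, Finset.sum_range]
  refine Finset.sum_congr rfl fun i _ => ?_
  rw [← hC.raw, rawInner_raw, inner_smul_right, norm_mul, hzi, one_mul]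

end Found

/-! ### Large numbers of qubits -/

theorem pair_lt_two_pow {n k : ℕ} (hn : 1 ≤ n) (hk : k ≤ n + 1) :
    Nat.pair n k < 2 ^ (2 * Nat.log 2 n + 6) := by
  have h1 := Nat.pair_lt_max_add_one_sq n k
  have h2 : max n k + 1 ≤ 3 * n := by omega
  have h3 : n < 2 ^ (Nat.log 2 n + 1) := Nat.lt_pow_succ_log_self (by norm_num) n
  calc Nat.pair n k < (max n k + 1) ^ 2 := h1
    _ ≤ (4 * 2 ^ (Nat.log 2 n + 1)) ^ 2 := Nat.pow_le_pow_left (by omega) 2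
    _ = 2 ^ (2 * Nat.log 2 n + 6) := by ring

theorem exists_le_overlap_of_large {U : List Bool →. List Bool} (hU : IsUniversalMachine U)
    {B : GateSet} (hB : B.IsUniversal) (hB' : B.HasComputableAmplitudes) :
    ∃ (c : ℝ) (n₀ : ℕ), 0 ≤ c ∧ ∀ n, n₀ ≤ n → 1 ≤ n → ∀ ε γ r s : ℝ, 0 ≤ ε → ε ≤ 1 → 0 ≤ γ →
      0 ≤ r → r + c * (1 + Real.logb 2 n) ≤ s → ∀ ψ : Qubits n, ‖ψ‖ = 1 →
        HbarSmooth U B (1 - ε) ψ ≤ (r : EReal) →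
          1 - √(2 * ε) - γ * (4 / (1 / 2)) ≤ overlap ψ (easyRobustSpan U B n s γ) := by
  obtain ⟨next, hnext, hsound, hcompl⟩ := exists_search hU.1 hB'
  obtain ⟨V, hV, hVout⟩ := exists_machine hnext
  obtain ⟨cV, hcV⟩ := hU.2 V hV
  obtain ⟨n₀, hdense⟩ := hB.exists_norm_output_sub_lt
  -- The programs have length at most 2(2⌊log₂ n⌋ + 6) + 1 + (k + 2) + cV with k ≤ r + 1, which is r
  -- + 4⌊log₂ n⌋ + 16 + cV.
  refine ⟨16 + cV, n₀, by positivity, fun n hn0 hn ε γ r s hε0 hε1 hγ hr0 hs ψ hψ hr => ?_⟩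
  set k := min ⌈r⌉₊ (n + 1) with hk
  have hbound : ∀ m L, L ∈ searchSeq next (n, k) m → m ≤ 3 * 2 ^ k := by
    intro m L hL
    obtain ⟨C, hC⟩ := exists_isFound hsound hL
    rw [← (searchSeq_spec hL).1]
    exact card_le_of_nearly_orthonormal hU.1 (fun i => norm_output _) hC.sum_le hC.lt_expect
  -- If a good circuit always remained, the search would find arbitrarily many, against `hbound`.
  obtain ⟨m, L, hL, hmax⟩ : ∃ m L, L ∈ searchSeq next (n, k) m ∧
      ∀ D : Circuit B n, ¬ IsGood U B n k L D := by
    by_contra hcon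
    push Not at hcon
    have : ∀ m, ∃ L, L ∈ searchSeq next (n, k) m := fun m => by
      induction m with
      | zero => exact ⟨[], Part.mem_some _⟩
      | succ m ih =>
        obtain ⟨L, hL⟩ := ih
        obtain ⟨S, hS⟩ := Part.dom_iff_mem.1 (hcompl n k L (hcon m L hL))
        exact ⟨_, mem_searchSeq_succ.2 ⟨L, hL, S, hS, rfl⟩⟩
    obtain ⟨L, hL⟩ := this (3 * 2 ^ k + 1)
    have := hbound _ L hL
    omega
  obtain ⟨C, hC⟩ := exists_isFound hsound hL
  have hlen := (searchSeq_spec hL).1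
  have hm : m < 2 ^ (k + 2) := by
    have h1 := hbound m L hL
    have h2 : 0 < 2 ^ k := by positivity
    rw [pow_add]
    omega
  have hcomplex : ∀ i, ketbra (Circuit.output (C i)) ∈ easyStates U B n s := by
    intro i
    have him : (i : ℕ) < m := hlen ▸ i.2
    obtain ⟨p, hp, hpV⟩ := hVout n k (2 * Nat.log 2 n + 6) m L
      (pair_lt_two_pow hn (min_le_right _ _)) hL i him (him.trans hm)
    obtain ⟨q, hq, hqp⟩ := hcV p _ hpV
    rw [← hC.raw i] at hq
    refine ketbra_output_mem_easyStates (q := q) hq ?_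
    have h1 : (q.length : ℝ) ≤ 2 * (2 * (Nat.log 2 n : ℝ) + 6) + 1 + (k + 2) + cV := by
      rw [hp] at hqp
      exact_mod_cast hqp
    have h2 : (k : ℝ) ≤ r + 1 :=
      (Nat.cast_le.2 (min_le_left _ _)).trans (Nat.ceil_lt_add_one hr0).le
    have h3 : (Nat.log 2 n : ℝ) ≤ Real.logb 2 n := by
      exact_mod_cast Real.natLog_le_logb n 2
    have h4 : (0 : ℝ) ≤ Nat.log 2 n := Nat.cast_nonneg _
    have h5 : (0 : ℝ) ≤ cV := Nat.cast_nonneg _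
    nlinarith [mul_nonneg h5 (h4.trans h3)]
  refine le_overlap_easyRobustSpan hU.1 hε0 hε1 hγ (by norm_num) hψ hr
    (fun i => Circuit.output (C i)) hcomplex ?_ (fun φ hφ =>
      le_sum_norm_inner_sq_of_nearly_orthonormal (fun i => norm_output _) hC.sum_le hφ) ?_
  -- Equal projectors would have overlap 1, above the near-orthogonality threshold.
  · have hne : ∀ i j, i < j → ketbra (Circuit.output (C i)) ≠ ketbra (Circuit.output (C j)) := by
      intro i j hij h
      have h1 : ‖(inner ℂ (Circuit.output (C i)) (Circuit.output (C j)) : ℂ)‖ ^ 2 = 1 := by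
        rw [← expect_ketbra, ← h, expect_ketbra, inner_self_eq_norm_sq_to_K, norm_output]
        simp
      have h2 := (Finset.single_le_sum (f := fun i =>
        ‖(inner ℂ (Circuit.output (C i)) (Circuit.output (C j)) : ℂ)‖ ^ 2)
        (fun _ _ => by positivity) (Finset.mem_filter.2 ⟨Finset.mem_univ i, hij⟩)).trans
        (hC.sum_le j)
      have h3 : ((1 : ℝ) / 4) ^ ((j : ℕ) + 2) < 1 :=
        pow_lt_one₀ (by norm_num) (by norm_num) (by omega)
      rw [h1] at h2
      linarith
    intro i j hij
    rcases lt_trichotomy i j with h | h | h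
    · exact absurd hij (hne i j h)
    · exact h
    · exact absurd hij.symm (hne j i h)
  · intro φ hφ hφ1
    have h1 := expect_le_of_not_isGood hC (hdense n hn0) hmax hφ1 hφ
    have h2 : (0 : ℝ) < ((2 : ℝ) ^ n)⁻¹ := by positivity
    rcases le_or_gt ⌈r⌉₊ (n + 1) with hle | hlt
    · rw [min_eq_left hle] at hk
      have h3 : ((2 : ℝ) ^ k)⁻¹ ≤ 2 ^ (-r) := by
        rw [← Real.rpow_natCast, ← Real.rpow_neg (by norm_num)]
        refine Real.rpow_le_rpow_of_exponent_le (by norm_num) (neg_le_neg ?_)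
        rw [hk]
        exact Nat.le_ceil r
      linarith
    -- At k = n + 1 the bound would read ⟨φ|μ|φ⟩ + 2^-n ≤ 2^-(n+1), which is impossible: the family
    -- spans the whole space.
    · rw [min_eq_right hlt.le] at hk
      have h3 := expect_semiDensity_nonneg (B := B) hU.1 φ
      rw [hk, pow_succ, mul_inv] at h1
      linarith

end QKol

end

theorem mainTheorem12 (U : List Bool →. List Bool) (hU : QKol.IsUniversalMachine U)
    (B : QKol.GateSet) (hB : B.IsUniversal) (hB' : B.HasComputableAmplitudes) :
    ∃ (c : ℝ) (P : Polynomial ℝ), ∀ n : ℕ, 1 ≤ n → ∀ ε γ r : ℝ, 0 ≤ ε → ε ≤ 1 → 0 ≤ γ →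
      ∀ ψ : QKol.Qubits n, ‖ψ‖ = 1 → QKol.HbarSmooth U B (1 - ε) ψ ≤ (r : EReal) →
        1 - √(2 * ε) - γ * P.eval (n : ℝ) ≤
          QKol.overlap ψ (QKol.easyRobustSpan U B n (r + c * (1 + Real.logb 2 n)) γ) := by
  obtain ⟨c, n₀, hc, hlarge⟩ := QKol.exists_le_overlap_of_large hU hB hB'
  choose d t ht hfixed using QKol.exists_le_overlap_of_fixed hU B
  have hd : 0 ≤ ∑ j ∈ Finset.range n₀, |d j| := Finset.sum_nonneg fun _ _ => abs_nonneg _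
  have ht' : 0 ≤ ∑ j ∈ Finset.range n₀, 4 / t j :=
    Finset.sum_nonneg fun j _ => div_nonneg (by norm_num) (ht j).le
  -- The 8 is 4/t for the frame bound t = 1/2 of large n; the sums dominate the constants of the
  -- finitely many n < n₀.
  refine ⟨c + ∑ j ∈ Finset.range n₀, |d j|,
    Polynomial.C (8 + ∑ j ∈ Finset.range n₀, 4 / t j), ?_⟩
  intro n hn ε γ r hε0 hε1 hγ ψ hψ hr
  rw [Polynomial.eval_C]
  -- The state `ψ` itself competes in the supremum, and its μ-expectation is at most 1.
  have hr0 : 0 ≤ r := by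
    have h1 : QKol.traceDist ψ ψ ≤ 1 - ε := by
      refine (QKol.traceDist_le hψ hψ).trans ?_
      rw [inner_self_eq_norm_sq_to_K, hψ]
      simpa using hε1
    have h2 : QKol.Hbar U B ψ ≤ (r : EReal) :=
      (le_iSup₂ (f := fun (w : QKol.Qubits n) (_ : ‖w‖ = 1 ∧ QKol.traceDist ψ w ≤ 1 - ε) =>
        QKol.Hbar U B w) ψ ⟨hψ, h1⟩).trans hr
    have h3 := (QKol.le_expect_of_Hbar_le hU.1 h2).trans
      (QKol.expect_semiDensity_le_one hU.1 hψ)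
    by_contra hneg
    exact absurd h3 (not_le.2 (Real.one_lt_rpow (by norm_num) (by linarith)))
  have hlog : 0 ≤ Real.logb 2 n := Real.logb_nonneg (by norm_num) (by exact_mod_cast hn)
  rcases le_or_gt n₀ n with h | h
  · refine le_trans ?_ (hlarge n h hn ε γ r _ hε0 hε1 hγ hr0 ?_ ψ hψ hr)
    · nlinarith
    · nlinarith
  · have h1 := Finset.single_le_sum (f := fun j => |d j|) (fun _ _ => abs_nonneg _)
      (Finset.mem_range.2 h)
    have h2 := Finset.single_le_sum (f := fun j => 4 / t j)
      (fun j _ => div_nonneg (by norm_num) (ht j).le) (Finset.mem_range.2 h)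
    refine le_trans ?_ (hfixed n ε γ r _ hε0 hε1 hγ ?_ ψ hψ hr)
    · nlinarith
    · have := le_abs_self (d n)
      nlinarith [mul_nonneg (add_nonneg hc hd) hlog]
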